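/- Let $S=(\mathbb{C}^n,0)$ with ring of holomorphic function germs $\mathcal{O}_S=\mathbb{C}\{x_1,\dots,x_n\}$, let $0\neq h\in\mathcal{O}_S$ with $h(0)=0$ be such that $\mathcal{O}_D:=\mathcal{O}_S/\mathcal{O}_S h$ is reduced, and let $D=\{h=0\}$ be the reduced divisor germ defined by $h$. Let $\mathcal{M}_D=Q(\mathcal{O}_D)$ be the total ring of fractions of $\mathcal{O}_D$. A *fractional ideal* on $D$ is a finitely generated $\mathcal{O}_D$-submodule of $\mathcal{M}_D$ which contains a non-zero-divisor, and for an $\mathcal{O}_D$-submodule $I\subseteq\mathcal{M}_D$ put $I^\vee=\{f\in\mathcal{M}_D\mid f\cdot I\subseteq\mathcal{O}_D\}$. Let - $\mathcal{J}_D=\langle\partial h/\partial x_1,\dots,\partial h/\partial x_n\rangle\subseteq\mathcal{O}_D$ be the Jacobian ideal; - $\mathcal{O}_{\widetilde D}$ be the normalization of $\mathcal{O}_D$, that is, its integral closure in $\mathcal{M}_D$; - $\mathcal{C}_D=\{a\in\mathcal{O}_D\mid a\,\mathcal{O}_{\widetilde D}\subseteq\mathcal{O}_D\}$ be the conductor ideal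 of the normalization; - $\Omega^1(\log D)=\{\omega\in\tfrac1h\Omega^1_S\mid d\omega\in\tfrac1h\Omega^2_S\}$ be the module of logarithmic $1$-forms along $D$; - $\mathcal{R}_D\subseteq\mathcal{M}_D$ be the $\mathcal{O}_D$-module of residues of logarithmic $1$-forms, that is, the set of all $\frac{\xi}{g}\big|_D$ where $\omega=\frac{dh}{h}\frac{\xi}{g}+\frac{\eta}{g}\in\Omega^1(\log D)$ with $\xi,g\in\mathcal{O}_S$, $\eta\in\Omega^1_S$, and $g$ restricting to a non-zero-divisor of $\mathcal{O}_D$. Then $\mathcal{J}_D$, $\mathcal{R}_D^\vee$, $\mathcal{C}_D$, $\mathcal{O}_D$, $\mathcal{O}_{\widetilde D}$ and $\mathcal{R}_D$ are fractional ideals on $D$, one has $\mathcal{C}_D=\mathcal{O}_{\widetilde D}^\vee$, and there is a chain of inclusions in $\mathcal{M}_D$ $$\mathcal{J}_D\subseteq\mathcal{R}_D^\vee\subseteq\mathcal{C}_D\subseteq\mathcal{O}_D\subseteq\mathcal{O}_{\widetilde D}\subseteq\mathcal{R}_D .$$ In particular, $\mathcal{J}_D\subseteq\mathcal{C}_D$.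 -/

import Mathlib

noncomputable section

namespace LogRes

open scoped nonZeroDivisors

/-- A formal power series `f = ∑ aₘ xᵐ` in `n` complex variables is convergent if
`∑ |aₘ| r^|m| < ∞` for some `r > 0`, i.e. if it converges absolutely on some polydisc
around the origin. -/
def IsConvergent {n : ℕ} (f : MvPowerSeries (Fin n) ℂ) : Prop :=
  ∃ r : ℝ, 0 < r ∧ Summable fun m : Fin n →₀ ℕ => ‖MvPowerSeries.coeff m f‖ * r ^ m.degree

theorem summable_of_le {n : ℕ} {f : MvPowerSeries (Fin n) ℂ} {r s : ℝ} (hs : 0 < s) (hsr : s ≤ r)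
    (hf : Summable fun m : Fin n →₀ ℕ => ‖MvPowerSeries.coeff m f‖ * r ^ m.degree) :
    Summable fun m : Fin n →₀ ℕ => ‖MvPowerSeries.coeff m f‖ * s ^ m.degree :=
  Summable.of_nonneg_of_le (fun _ => by positivity) (fun _ => by gcongr) hf

theorem IsConvergent.add {n : ℕ} {f g : MvPowerSeries (Fin n) ℂ}
    (hf : IsConvergent f) (hg : IsConvergent g) : IsConvergent (f + g) := by
  obtain ⟨r, hr, hf⟩ := hf
  obtain ⟨s, hs, hg⟩ := hg
  have ht : 0 < min r s := lt_min hr hs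
  refine ⟨min r s, ht, Summable.of_nonneg_of_le (fun _ => by positivity) (fun m => ?_)
    ((summable_of_le ht (min_le_left r s) hf).add (summable_of_le ht (min_le_right r s) hg))⟩
  rw [← add_mul, map_add]
  gcongr
  exact norm_add_le _ _

theorem summable_cauchyProduct {n : ℕ} {a b : (Fin n →₀ ℕ) → ℝ} (ha : ∀ m, 0 ≤ a m)
    (hb : ∀ m, 0 ≤ b m) (hsa : Summable a) (hsb : Summable b) :
    Summable fun m : Fin n →₀ ℕ =>
      ∑ p ∈ Finset.HasAntidiagonal.antidiagonal m, a p.1 * b p.2 :=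
  summable_sum_mul_antidiagonal_of_summable_mul (hsa.mul_of_nonneg hsb ha hb)

theorem norm_coeff_mul_le {n : ℕ} {f g : MvPowerSeries (Fin n) ℂ} {t : ℝ} (ht : 0 < t)
    (m : Fin n →₀ ℕ) :
    ‖MvPowerSeries.coeff m (f * g)‖ * t ^ m.degree ≤
      ∑ p ∈ Finset.HasAntidiagonal.antidiagonal m,
        (‖MvPowerSeries.coeff p.1 f‖ * t ^ p.1.degree) *
          (‖MvPowerSeries.coeff p.2 g‖ * t ^ p.2.degree) := by
  rw [MvPowerSeries.coeff_mul]
  refine (mul_le_mul_of_nonneg_right (norm_sum_le _ _) (by positivity)).trans (le_of_eq ?_)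
  rw [Finset.sum_mul]
  refine Finset.sum_congr rfl fun p hp => ?_
  rw [← Finset.HasAntidiagonal.mem_antidiagonal.mp hp, map_add, pow_add, norm_mul]
  ring

theorem summable_mul {n : ℕ} {f g : MvPowerSeries (Fin n) ℂ} {t : ℝ} (ht : 0 < t)
    (hf : Summable fun m : Fin n →₀ ℕ => ‖MvPowerSeries.coeff m f‖ * t ^ m.degree)
    (hg : Summable fun m : Fin n →₀ ℕ => ‖MvPowerSeries.coeff m g‖ * t ^ m.degree) :
    Summable fun m : Fin n →₀ ℕ => ‖MvPowerSeries.coeff m (f * g)‖ * t ^ m.degree := by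
  have h0 : ∀ (k : MvPowerSeries (Fin n) ℂ) (m : Fin n →₀ ℕ),
      0 ≤ ‖MvPowerSeries.coeff m k‖ * t ^ m.degree :=
    fun k m => mul_nonneg (norm_nonneg _) (pow_nonneg ht.le _)
  have h := summable_cauchyProduct (h0 f) (h0 g) hf hg
  exact Summable.of_nonneg_of_le (h0 (f * g)) (norm_coeff_mul_le ht) h

theorem IsConvergent.mul {n : ℕ} {f g : MvPowerSeries (Fin n) ℂ}
    (hf : IsConvergent f) (hg : IsConvergent g) : IsConvergent (f * g) := by
  obtain ⟨r, hr, hf⟩ := hf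
  obtain ⟨s, hs, hg⟩ := hg
  have ht : 0 < min r s := lt_min hr hs
  have hf' := summable_of_le ht (min_le_left r s) hf
  have hg' := summable_of_le ht (min_le_right r s) hg
  exact ⟨min r s, ht, summable_mul ht hf' hg'⟩

theorem isConvergent_C {n : ℕ} (c : ℂ) :
    IsConvergent (MvPowerSeries.C c : MvPowerSeries (Fin n) ℂ) := by
  classical
  refine ⟨1, one_pos, summable_of_ne_finset_zero (s := {0}) fun m hm => ?_⟩
  rw [MvPowerSeries.coeff_C, if_neg (by simpa using hm)]
  simp

theorem IsConvergent.pderiv {n : ℕ} {f : MvPowerSeries (Fin n) ℂ} (i : Fin n)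
    (hf : IsConvergent f) : IsConvergent (MvPowerSeries.pderiv ℂ i f) := by
  obtain ⟨r, hr, hf⟩ := hf
  have hinj : Function.Injective fun m : Fin n →₀ ℕ => m + Finsupp.single i 1 :=
    add_left_injective _
  refine ⟨r / 2, by positivity, Summable.of_nonneg_of_le (fun _ => by positivity) (fun m => ?_)
    ((hf.comp_injective hinj).mul_left r⁻¹)⟩
  have h1 : ((m i : ℝ) + 1) ≤ 2 ^ m.degree := by
    have h2 : m i ≤ m.degree := Finsupp.le_degree i m
    have h3 : m.degree < 2 ^ m.degree := Nat.lt_two_pow_self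
    have h4 : m i + 1 ≤ 2 ^ m.degree := by omega
    exact_mod_cast h4
  have h5 : ‖((m i : ℂ) + 1)‖ = (m i : ℝ) + 1 := by
    have : ((m i : ℂ) + 1) = ((m i + 1 : ℕ) : ℂ) := by push_cast; rfl
    rw [this, Complex.norm_natCast]; push_cast; rfl
  simp only [Function.comp_apply]
  rw [MvPowerSeries.coeff_pderiv, norm_mul, h5, map_add, Finsupp.degree_single, pow_succ, div_pow]
  calc _ ≤ ‖MvPowerSeries.coeff (m + Finsupp.single i 1) f‖ * 2 ^ m.degree
          * (r ^ m.degree / 2 ^ m.degree) := by gcongr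
    _ = _ := by field_simp

/-- The ring `𝒪_S = ℂ{x₁, …, xₙ}` of convergent power series, that is, the ring of germs at the
origin of holomorphic functions on `S = (ℂⁿ, 0)`. -/
def convergentSubalgebra (n : ℕ) : Subalgebra ℂ (MvPowerSeries (Fin n) ℂ) where
  carrier := {f | IsConvergent f}
  mul_mem' := IsConvergent.mul
  add_mem' := IsConvergent.add
  algebraMap_mem' c := isConvergent_C c

/-- `𝒪_S = ℂ{x₁, …, xₙ}`. -/
def OS (n : ℕ) : Type := convergentSubalgebra n

instance (n : ℕ) : CommRing (OS n) := inferInstanceAs (CommRing (convergentSubalgebra n))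

instance (n : ℕ) : Algebra ℂ (OS n) := inferInstanceAs (Algebra ℂ (convergentSubalgebra n))

/-- The power series expansion of an element of `𝒪_S`. -/
def toSeries (n : ℕ) : OS n →ₐ[ℂ] MvPowerSeries (Fin n) ℂ := (convergentSubalgebra n).val

theorem toSeries_injective (n : ℕ) : Function.Injective (toSeries n) := Subtype.val_injective

instance (n : ℕ) : IsDomain (OS n) :=
  haveI : IsDomain (MvPowerSeries (Fin n) ℂ) := NoZeroDivisors.to_isDomain _
  (toSeries_injective n).isDomain (toSeries n)

/-- The field `Q(𝒪_S)` of germs of meromorphic functions on `S`. -/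
abbrev MS (n : ℕ) : Type := FractionRing (OS n)

/-- The partial derivative `∂/∂xᵢ` on `𝒪_S`. -/
def partialOS {n : ℕ} (i : Fin n) (f : OS n) : OS n :=
  ⟨MvPowerSeries.pderiv ℂ i (toSeries n f), IsConvergent.pderiv i f.2⟩

theorem partialOS_add {n : ℕ} (i : Fin n) (f g : OS n) :
    partialOS i (f + g) = partialOS i f + partialOS i g :=
  toSeries_injective n (map_add (MvPowerSeries.pderiv ℂ i) (toSeries n f) (toSeries n g))

theorem partialOS_mul {n : ℕ} (i : Fin n) (f g : OS n) :
    partialOS i (f * g) = f * partialOS i g + g * partialOS i f :=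
  toSeries_injective n ((MvPowerSeries.pderiv ℂ i).leibniz (toSeries n f) (toSeries n g))

/-- The partial derivative `∂/∂xᵢ` of a meromorphic germ `a / b`, by the quotient rule
`(b ∂ᵢa - a ∂ᵢb) / b²`; it does not depend on the chosen fraction, see `partialMS_div`. -/
def partialMS {n : ℕ} (i : Fin n) (x : MS n) : MS n :=
  let a : OS n := (IsLocalization.sec (OS n)⁰ x).1
  let b : OS n := (IsLocalization.sec (OS n)⁰ x).2
  algebraMap (OS n) (MS n) (b * partialOS i a - a * partialOS i b) / algebraMap (OS n) (MS n) b ^ 2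

theorem partialMS_div {n : ℕ} (i : Fin n) (a b : OS n) (hb : b ≠ 0) :
    partialMS i (algebraMap (OS n) (MS n) a / algebraMap (OS n) (MS n) b) =
      algebraMap (OS n) (MS n) (b * partialOS i a - a * partialOS i b) /
        algebraMap (OS n) (MS n) b ^ 2 := by
  set x : MS n := algebraMap (OS n) (MS n) a / algebraMap (OS n) (MS n) b with hx
  have hs := IsLocalization.sec_spec (OS n)⁰ x
  unfold partialMS
  set a' : OS n := (IsLocalization.sec (OS n)⁰ x).1
  set b' : OS n := ((IsLocalization.sec (OS n)⁰ x).2 : OS n)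
  have hb' : b' ≠ 0 := nonZeroDivisors.ne_zero (IsLocalization.sec (OS n)⁰ x).2.2
  have hinj := IsFractionRing.injective (OS n) (MS n)
  have hbM : algebraMap (OS n) (MS n) b ≠ 0 := by simpa using hb
  have hbM' : algebraMap (OS n) (MS n) b' ≠ 0 := by simpa using hb'
  have key : a * b' = a' * b := by
    apply hinj
    rw [map_mul, map_mul, ← hs, hx]
    field_simp
  have hd := congrArg (partialOS i) key
  rw [partialOS_mul, partialOS_mul] at hd
  change algebraMap (OS n) (MS n) (b' * partialOS i a' - a' * partialOS i b') / _ = _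
  rw [div_eq_div_iff (pow_ne_zero 2 hbM') (pow_ne_zero 2 hbM), ← map_pow, ← map_pow, ← map_mul,
    ← map_mul]
  congr 1
  linear_combination (b' * partialOS i b + b * partialOS i b') * key - b * b' * hd

theorem partialMS_add {n : ℕ} (i : Fin n) (x y : MS n) :
    partialMS i (x + y) = partialMS i x + partialMS i y := by
  obtain ⟨a, b, hb, rfl⟩ := IsFractionRing.div_surjective (A := OS n) x
  obtain ⟨c, d, hd, rfl⟩ := IsFractionRing.div_surjective (A := OS n) y
  have hb0 := nonZeroDivisors.ne_zero hb
  have hd0 := nonZeroDivisors.ne_zero hd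
  have hbM : algebraMap (OS n) (MS n) b ≠ 0 := by simpa using hb0
  have hdM : algebraMap (OS n) (MS n) d ≠ 0 := by simpa using hd0
  rw [div_add_div _ _ hbM hdM, ← map_mul, ← map_mul, ← map_mul, ← map_add,
    partialMS_div i _ _ (mul_ne_zero hb0 hd0), partialMS_div i _ _ hb0, partialMS_div i _ _ hd0]
  simp only [partialOS_mul, partialOS_add, map_mul, map_add, map_sub]
  field_simp
  ring

theorem partialMS_smul {n : ℕ} (i : Fin n) (f : OS n) (x : MS n) :
    partialMS i (f • x) = f • partialMS i x + partialOS i f • x := by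
  obtain ⟨a, b, hb, rfl⟩ := IsFractionRing.div_surjective (A := OS n) x
  have hb0 := nonZeroDivisors.ne_zero hb
  have hbM : algebraMap (OS n) (MS n) b ≠ 0 := by simpa using hb0
  rw [Algebra.smul_def, Algebra.smul_def, Algebra.smul_def, ← mul_div_assoc, ← map_mul,
    partialMS_div i _ _ hb0, partialMS_div i _ _ hb0]
  simp only [partialOS_mul, map_mul, map_add, map_sub]
  field_simp
  ring

/-! ### Logarithmic 1-forms

The module `Ω¹_S` of germs of holomorphic 1-forms is free on `dx₁, …, dxₙ`. A meromorphic 1-form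
`∑ ωᵢ dxᵢ` is given by its coefficients `ω : Fin n → MS n`; a meromorphic 2-form
`∑_{i<j} ηᵢⱼ dxᵢ ∧ dxⱼ` is given by its (antisymmetric) array of coefficients. -/

/-- The exterior derivative of 1-forms: `(dω)ᵢⱼ = ∂ᵢ ωⱼ - ∂ⱼ ωᵢ`. -/
def extDeriv {n : ℕ} (ω : Fin n → MS n) : Fin n → Fin n → MS n :=
  fun i j => partialMS i (ω j) - partialMS j (ω i)

/-- A meromorphic function lies in `𝒪_S(D) = (1/h) 𝒪_S`. -/
def HasSimplePole {n : ℕ} (h : OS n) (x : MS n) : Prop :=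
  ∃ f : OS n, algebraMap (OS n) (MS n) h * x = algebraMap (OS n) (MS n) f

theorem HasSimplePole.add {n : ℕ} {h : OS n} {x y : MS n} (hx : HasSimplePole h x)
    (hy : HasSimplePole h y) : HasSimplePole h (x + y) := by
  obtain ⟨f, hf⟩ := hx
  obtain ⟨g, hg⟩ := hy
  exact ⟨f + g, by rw [mul_add, hf, hg, map_add]⟩

theorem HasSimplePole.smul {n : ℕ} {h : OS n} {x : MS n} (f : OS n) (hx : HasSimplePole h x) :
    HasSimplePole h (f • x) := by
  obtain ⟨g, hg⟩ := hx
  exact ⟨f * g, by rw [Algebra.smul_def, mul_left_comm, hg, map_mul]⟩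

/-- The `𝒪_S`-module `Ω¹(log D)` of logarithmic 1-forms along `D = {h = 0}`:
`ω ∈ Ω¹_S(D)` and `dω ∈ Ω²_S(D)`. -/
def logForms {n : ℕ} (h : OS n) : Submodule (OS n) (Fin n → MS n) where
  carrier := {ω | (∀ i, HasSimplePole h (ω i)) ∧ ∀ i j, HasSimplePole h (extDeriv ω i j)}
  zero_mem' := by
    have h0 : ∀ i : Fin n, partialMS i (0 : MS n) = 0 := fun i => by
      simpa using partialMS_add i (0 : MS n) 0
    exact ⟨fun i => ⟨0, by simp⟩, fun i j => ⟨0, by simp [extDeriv, h0]⟩⟩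
  add_mem' := by
    rintro ω ω' ⟨h1, h2⟩ ⟨h1', h2'⟩
    refine ⟨fun i => (h1 i).add (h1' i), fun i j => ?_⟩
    have : extDeriv (ω + ω') i j = extDeriv ω i j + extDeriv ω' i j := by
      simp only [extDeriv, Pi.add_apply, partialMS_add]; ring
    rw [this]
    exact (h2 i j).add (h2' i j)
  smul_mem' := by
    rintro f ω ⟨h1, h2⟩
    refine ⟨fun i => (h1 i).smul f, fun i j => ?_⟩
    have : extDeriv (f • ω) i j =
        f • extDeriv ω i j + (partialOS i f • ω j + (-partialOS j f) • ω i) := by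
      simp only [extDeriv, Pi.smul_apply, partialMS_smul, smul_sub, neg_smul]; ring
    rw [this]
    exact ((h2 i j).smul f).add (((h1 j).smul _).add ((h1 i).smul _))

/-! ### The divisor -/

/-- `𝒪_D = 𝒪_S / 𝒪_S h`. -/
abbrev OD {n : ℕ} (h : OS n) : Type := OS n ⧸ Ideal.span {h}

/-- The total ring of fractions `ℳ_D = Q(𝒪_D)` of `𝒪_D`: the ring of meromorphic functions
on `D`. -/
abbrev MD {n : ℕ} (h : OS n) : Type := FractionRing (OD h)

/-- Restriction `f ↦ f|_D` of functions to `D`. -/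
def toOD {n : ℕ} (h : OS n) : OS n →+* OD h := Ideal.Quotient.mk (Ideal.span {h})

/-- The restriction `f|_D`, as a meromorphic function on `D`. -/
def toMD {n : ℕ} (h : OS n) : OS n →+* MD h := (algebraMap (OD h) (MD h)).comp (toOD h)

/-- `ρ ∈ ℳ_D` is the residue of the meromorphic 1-form `ω`: one can write
`ω = (dh / h) (ξ / g) + η / g` with `ξ, g ∈ 𝒪_S`, `η ∈ Ω¹_S`, where `g` restricts to a non-zero
divisor in `𝒪_D`, and `ρ = (ξ / g)|_D`. -/
def IsResidue {n : ℕ} (h : OS n) (ω : Fin n → MS n) (ρ : MD h) : Prop :=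
  ∃ (ξ g : OS n) (η : Fin n → OS n), toOD h g ∈ (OD h)⁰ ∧
    (∀ i, algebraMap (OS n) (MS n) g * ω i =
      algebraMap (OS n) (MS n) (partialOS i h) / algebraMap (OS n) (MS n) h *
        algebraMap (OS n) (MS n) ξ + algebraMap (OS n) (MS n) (η i)) ∧
    ρ * toMD h g = toMD h ξ

/-- The `𝒪_D`-module `ℛ_D = ρ_D(Ω¹(log D)) ⊆ ℳ_D` of residues of logarithmic 1-forms. -/
def residues {n : ℕ} (h : OS n) : Submodule (OD h) (MD h) where
  carrier := {ρ | ∃ ω ∈ logForms h, IsResidue h ω ρ}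
  zero_mem' := ⟨0, Submodule.zero_mem _, 0, 1, 0, by rw [map_one]; exact one_mem _,
    by simp, by simp⟩
  add_mem' := by
    rintro ρ ρ' ⟨ω, hω, ξ, g, η, hg, h1, h2⟩ ⟨ω', hω', ξ', g', η', hg', h1', h2'⟩
    refine ⟨ω + ω', Submodule.add_mem _ hω hω', g' * ξ + g * ξ', g * g', g' • η + g • η', ?_,
      fun i => ?_, ?_⟩
    · rw [map_mul]; exact mul_mem hg hg'
    · simp only [Pi.add_apply, Pi.smul_apply, smul_eq_mul, map_mul, map_add]
      linear_combination algebraMap (OS n) (MS n) g' * h1 i + algebraMap (OS n) (MS n) g * h1' i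
    · simp only [map_mul, map_add]
      linear_combination toMD h g' * h2 + toMD h g * h2'
  smul_mem' := by
    rintro c ρ ⟨ω, hω, ξ, g, η, hg, h1, h2⟩
    obtain ⟨f, rfl⟩ := Ideal.Quotient.mk_surjective c
    refine ⟨f • ω, Submodule.smul_mem _ f hω, f * ξ, g, f • η, hg, fun i => ?_, ?_⟩
    · simp only [Pi.smul_apply, smul_eq_mul, map_mul, Algebra.smul_def]
      linear_combination algebraMap (OS n) (MS n) f * h1 i
    · rw [Algebra.smul_def, map_mul, mul_assoc, h2]
      rfl

/-- The Jacobian ideal `𝒥_D = ⟨∂h/∂x₁, …, ∂h/∂xₙ⟩ ⊆ 𝒪_D`. -/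
def jacobianIdeal {n : ℕ} (h : OS n) : Ideal (OD h) :=
  Ideal.span (Set.range fun i : Fin n => toOD h (partialOS i h))

/-- `𝒪_{D̃}`: the normalization of `𝒪_D`, i.e. its integral closure in `ℳ_D`. -/
def normalization {n : ℕ} (h : OS n) : Subalgebra (OD h) (MD h) :=
  integralClosure (OD h) (MD h)

/-- The conductor ideal `𝒞_D = {a ∈ 𝒪_D | a 𝒪_{D̃} ⊆ 𝒪_D}` of the normalization. -/
def conductorIdeal {n : ℕ} (h : OS n) : Ideal (OD h) where
  carrier := {a | ∀ b ∈ normalization h, ∃ c : OD h, a • b = algebraMap (OD h) (MD h) c}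
  zero_mem' b _ := ⟨0, by simp⟩
  add_mem' := by
    intro a a' ha ha' b hb
    obtain ⟨c, hc⟩ := ha b hb
    obtain ⟨c', hc'⟩ := ha' b hb
    exact ⟨c + c', by rw [add_smul, hc, hc', map_add]⟩
  smul_mem' := by
    intro r a ha b hb
    obtain ⟨c, hc⟩ := ha b hb
    exact ⟨r * c, by rw [smul_assoc, hc, map_mul, Algebra.smul_def]⟩

/-- An ideal of `𝒪_D`, viewed as an `𝒪_D`-submodule of `ℳ_D`. -/
def idealToMD {n : ℕ} (h : OS n) (I : Ideal (OD h)) : Submodule (OD h) (MD h) :=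
  Submodule.map (Algebra.linearMap (OD h) (MD h)) I

/-- The dual `I^∨ = {f ∈ ℳ_D | f I ⊆ 𝒪_D}` of an `𝒪_D`-submodule `I` of `ℳ_D`. -/
def dual {n : ℕ} (h : OS n) (I : Submodule (OD h) (MD h)) : Submodule (OD h) (MD h) :=
  idealToMD h ⊤ / I

/-- A fractional ideal on `D`: a finite `𝒪_D`-submodule of `ℳ_D` which contains a non-zero
divisor. -/
def IsFractionalIdeal {n : ℕ} (h : OS n) (I : Submodule (OD h) (MD h)) : Prop :=
  I.FG ∧ ∃ x ∈ I, x ∈ (MD h)⁰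

end LogRes

end

noncomputable section

namespace LogRes

open scoped nonZeroDivisors ENNReal NNReal

/-! The residues form the dual of the Jacobian ideal: `f` is a residue exactly when every `∂ᵢh · f`
lies in `𝒪_D` (`mem_residues_of_forall`, `partialOS_mem_multipliers_of_mem_residues`). Indeed, if
`aᵢ` lifts `∂ᵢh · f`, then `∑ (aᵢ / h) dxᵢ` is logarithmic with residue `f`. So the essential point
is that the partials of `h` multiply the normalization into `𝒪_D`; the other inclusions are formal.

For a generic direction `(1, c)`, Weierstrass preparation identifies `𝒪_D` with `A[X] / P`, where
`A` is the ring of convergent series in one variable fewer and `P` is monic (`exists_generic`). The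
derivative of `h` in this direction becomes a unit times the class of `P'`. Since `A` is integrally
closed and `P` is separable over `Frac A`, the product of `P'` and an integral element `f` is
represented by the interpolation polynomial `∑ f(α) ∏_{β ≠ α} (X - β)` over the roots of `P`. Its
coefficients are integral over `A` and lie in `Frac A`, hence in `A` (`exists_derivative_mul_eq`).
Generic directions span, so all partials are reached (`partialOS_mem_multipliers`).

The class of `P'` is also a nonzerodivisor, so the Jacobian ideal contains a nonzerodivisor `x`.
Multiplication by `x` embeds the residues into the noetherian ring `𝒪_D`, which makes every term of
the chain finitely generated. Noetherianity and factoriality come from the same Weierstrass theory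
by induction on `n`. That theory rests on a contraction argument in weighted `ℓ¹`-norms
(`exists_eq_add_shift_mul`). -/

/-! ### Weighted `ℓ¹`-norms of power series -/

/-- The monomial `∏ wᵢ ^ mᵢ` in the weights `w`. -/
def wmon {n : ℕ} (w : Fin n → ℝ≥0∞) (m : Fin n →₀ ℕ) : ℝ≥0∞ := ∏ i, w i ^ m i

theorem wmon_add {n : ℕ} (w : Fin n → ℝ≥0∞) (a b : Fin n →₀ ℕ) :
    wmon w (a + b) = wmon w a * wmon w b := by
  simp [wmon, pow_add, Finset.prod_mul_distrib]

@[simp] theorem wmon_zero {n : ℕ} (w : Fin n → ℝ≥0∞) : wmon w 0 = 1 := by simp [wmon]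

theorem wmon_mono {n : ℕ} {w w' : Fin n → ℝ≥0∞} (h : ∀ i, w i ≤ w' i) (m : Fin n →₀ ℕ) :
    wmon w m ≤ wmon w' m :=
  Finset.prod_le_prod' fun i _ => pow_le_pow_left' (h i) _

theorem wmon_const {n : ℕ} (r : ℝ≥0∞) (m : Fin n →₀ ℕ) :
    wmon (fun _ => r) m = r ^ m.degree := by
  rw [wmon, Finset.prod_pow_eq_pow_sum, Finsupp.degree_eq_sum]

theorem wmon_ne_zero {n : ℕ} {w : Fin n → ℝ≥0∞} (h : ∀ i, w i ≠ 0) (m : Fin n →₀ ℕ) :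
    wmon w m ≠ 0 :=
  Finset.prod_ne_zero_iff.mpr fun i _ => pow_ne_zero _ (h i)

theorem wmon_ne_top {n : ℕ} {w : Fin n → ℝ≥0∞} (h : ∀ i, w i ≠ ∞) (m : Fin n →₀ ℕ) :
    wmon w m ≠ ∞ :=
  ENNReal.prod_ne_top fun i _ => ENNReal.pow_ne_top (h i)

/-- The weighted `ℓ¹`-norm `∑ |fₘ| wᵐ` of a power series. -/
def wnorm {n : ℕ} (w : Fin n → ℝ≥0∞) (f : MvPowerSeries (Fin n) ℂ) : ℝ≥0∞ :=
  ∑' m, ‖MvPowerSeries.coeff m f‖ₑ * wmon w m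

theorem wnorm_mono {n : ℕ} {w w' : Fin n → ℝ≥0∞} (h : ∀ i, w i ≤ w' i)
    (f : MvPowerSeries (Fin n) ℂ) : wnorm w f ≤ wnorm w' f :=
  ENNReal.tsum_le_tsum fun m => mul_le_mul_right (wmon_mono h m) _

theorem isConvergent_iff {n : ℕ} {f : MvPowerSeries (Fin n) ℂ} :
    IsConvergent f ↔ ∃ r : ℝ≥0, 0 < r ∧ wnorm (fun _ => (r : ℝ≥0∞)) f ≠ ∞ := by
  have key : ∀ r : ℝ≥0, wnorm (fun _ => (r : ℝ≥0∞)) f ≠ ∞ ↔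
      Summable fun m : Fin n →₀ ℕ => ‖MvPowerSeries.coeff m f‖ * (r : ℝ) ^ m.degree := by
    intro r
    have : wnorm (fun _ => (r : ℝ≥0∞)) f =
        ∑' m : Fin n →₀ ℕ, ((‖MvPowerSeries.coeff m f‖₊ * r ^ m.degree : ℝ≥0) : ℝ≥0∞) := by
      refine tsum_congr fun m => ?_
      rw [wmon_const]; push_cast; rfl
    rw [this, ENNReal.tsum_coe_ne_top_iff_summable, ← NNReal.summable_coe]
    simp
  constructor
  · rintro ⟨r, hr, h⟩
    exact ⟨⟨r, hr.le⟩, hr, (key _).mpr h⟩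
  · rintro ⟨r, hr, h⟩
    exact ⟨r, hr, (key r).mp h⟩

theorem isConvergent_of_wnorm {n : ℕ} {f : MvPowerSeries (Fin n) ℂ} {w : Fin n → ℝ≥0∞}
    (hw : ∀ i, w i ≠ 0) (h : wnorm w f ≠ ∞) : IsConvergent f := by
  have : ∃ r : ℝ≥0, 0 < r ∧ ∀ i, (r : ℝ≥0∞) ≤ w i := by
    have h1 : 0 < Finset.univ.inf fun i => min (w i) 1 := by
      rw [Finset.lt_inf_iff (by simp)]
      exact fun i _ => lt_min (pos_iff_ne_zero.mpr (hw i)) one_pos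
    obtain ⟨r, hr0, hr⟩ := ENNReal.lt_iff_exists_nnreal_btwn.mp h1
    refine ⟨r, by exact_mod_cast hr0, fun i => ?_⟩
    exact hr.le.trans ((Finset.inf_le (Finset.mem_univ i)).trans (min_le_left _ _))
  obtain ⟨r, hr, hrw⟩ := this
  exact isConvergent_iff.mpr ⟨r, hr, ne_top_of_le_ne_top h (wnorm_mono hrw f)⟩

theorem wnorm_mul_le {n : ℕ} (w : Fin n → ℝ≥0∞) (f g : MvPowerSeries (Fin n) ℂ) :
    wnorm w (f * g) ≤ wnorm w f * wnorm w g := by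
  classical
  calc wnorm w (f * g)
      ≤ ∑' m, ∑ p ∈ Finset.HasAntidiagonal.antidiagonal m,
          (‖MvPowerSeries.coeff p.1 f‖ₑ * wmon w p.1) *
            (‖MvPowerSeries.coeff p.2 g‖ₑ * wmon w p.2) := by
        refine ENNReal.tsum_le_tsum fun m => ?_
        rw [MvPowerSeries.coeff_mul]
        refine (mul_le_mul_left (enorm_sum_le _ _) _).trans (le_of_eq ?_)
        rw [Finset.sum_mul]
        refine Finset.sum_congr rfl fun p hp => ?_
        rw [← Finset.HasAntidiagonal.mem_antidiagonal.mp hp, wmon_add, enorm_mul]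
        ring
    _ = ∑' p : (Fin n →₀ ℕ) × (Fin n →₀ ℕ), (‖MvPowerSeries.coeff p.1 f‖ₑ * wmon w p.1) *
            (‖MvPowerSeries.coeff p.2 g‖ₑ * wmon w p.2) := by
        rw [← Finset.HasAntidiagonal.sigmaAntidiagonalEquivProd.tsum_eq, ENNReal.tsum_sigma']
        refine tsum_congr fun m => ?_
        rw [← Finset.tsum_subtype]
        rfl
    _ = wnorm w f * wnorm w g := by
        rw [ENNReal.tsum_prod']
        simp_rw [ENNReal.tsum_mul_left, ENNReal.tsum_mul_right]
        rfl

theorem wnorm_C {n : ℕ} (w : Fin n → ℝ≥0∞) (c : ℂ) :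
    wnorm w (MvPowerSeries.C c) = ‖c‖ₑ := by
  classical
  rw [wnorm, tsum_eq_single 0]
  · simp
  · intro m hm
    simp [MvPowerSeries.coeff_C, hm]

theorem wnorm_one {n : ℕ} (w : Fin n → ℝ≥0∞) : wnorm w 1 = 1 := by
  simpa using wnorm_C w 1

theorem wnorm_pow_le {n : ℕ} (w : Fin n → ℝ≥0∞) (f : MvPowerSeries (Fin n) ℂ) (k : ℕ) :
    wnorm w (f ^ k) ≤ wnorm w f ^ k := by
  induction k with
  | zero => simp [wnorm_one]
  | succ k ih => rw [pow_succ, pow_succ]; exact (wnorm_mul_le w _ _).trans (by gcongr)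

theorem wnorm_prod_le {n : ℕ} {ι : Type*} (w : Fin n → ℝ≥0∞) (s : Finset ι)
    (f : ι → MvPowerSeries (Fin n) ℂ) :
    wnorm w (∏ i ∈ s, f i) ≤ ∏ i ∈ s, wnorm w (f i) := by
  classical
  induction s using Finset.induction_on with
  | empty => simp [wnorm_one]
  | insert a s ha ih =>
    rw [Finset.prod_insert ha, Finset.prod_insert ha]
    exact (wnorm_mul_le w _ _).trans (by gcongr)

theorem wnorm_add_le {n : ℕ} (w : Fin n → ℝ≥0∞) (f g : MvPowerSeries (Fin n) ℂ) :
    wnorm w (f + g) ≤ wnorm w f + wnorm w g := by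
  rw [wnorm, wnorm, wnorm, ← ENNReal.tsum_add]
  refine ENNReal.tsum_le_tsum fun m => ?_
  rw [← add_mul, map_add]
  gcongr
  exact enorm_add_le _ _

theorem wnorm_monomial {n : ℕ} (w : Fin n → ℝ≥0∞) (e : Fin n →₀ ℕ) (c : ℂ) :
    wnorm w (MvPowerSeries.monomial e c) = ‖c‖ₑ * wmon w e := by
  classical
  rw [wnorm, tsum_eq_single e]
  · simp
  · intro m hm
    simp [MvPowerSeries.coeff_monomial, hm]

theorem le_wnorm {n : ℕ} (w : Fin n → ℝ≥0∞) (f : MvPowerSeries (Fin n) ℂ) (m : Fin n →₀ ℕ) :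
    ‖MvPowerSeries.coeff m f‖ₑ * wmon w m ≤ wnorm w f :=
  ENNReal.le_tsum m

theorem eq_zero_of_wnorm_eq_zero {n : ℕ} {w : Fin n → ℝ≥0∞} (hw : ∀ i, w i ≠ 0)
    {f : MvPowerSeries (Fin n) ℂ} (h : wnorm w f = 0) : f = 0 := by
  ext m
  have := le_wnorm w f m
  rw [h, nonpos_iff_eq_zero, mul_eq_zero, or_iff_left (wmon_ne_zero hw m)] at this
  simpa using this

/-- If every monomial of `g` involves one of the variables in `T`, then scaling the weights in `T`
by `t ≤ 1` scales the norm of `g` by at least `t`. -/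
theorem wnorm_scale_le {n : ℕ} {w w' : Fin n → ℝ≥0∞} {t : ℝ≥0∞} (T : Set (Fin n))
    (h1 : ∀ i, w' i ≤ w i) (hT : ∀ i ∈ T, w' i ≤ t * w i) {g : MvPowerSeries (Fin n) ℂ}
    (hg : ∀ m, MvPowerSeries.coeff m g ≠ 0 → ∃ i ∈ T, m i ≠ 0) :
    wnorm w' g ≤ t * wnorm w g := by
  classical
  rw [wnorm, wnorm, ← ENNReal.tsum_mul_left]
  refine ENNReal.tsum_le_tsum fun m => ?_
  by_cases hm : MvPowerSeries.coeff m g = 0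
  · simp [hm]
  obtain ⟨i, hi, hmi⟩ := hg m hm
  rw [mul_left_comm]
  gcongr
  rw [wmon, wmon, ← Finset.mul_prod_erase _ _ (Finset.mem_univ i),
    ← Finset.mul_prod_erase Finset.univ (fun i => w i ^ m i) (Finset.mem_univ i), ← mul_assoc]
  refine mul_le_mul' ?_ (Finset.prod_le_prod' fun j _ => pow_le_pow_left' (h1 j) _)
  obtain ⟨k, hk⟩ := Nat.exists_eq_succ_of_ne_zero hmi
  rw [hk, pow_succ', pow_succ', ← mul_assoc]
  exact mul_le_mul' (hT i hi) (pow_le_pow_left' (h1 i) _)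

/-! ### Coefficient shifts and a contraction principle -/

/-- The power series with coefficients `fₘ₊ₑ`. -/
def shift {n : ℕ} (e : Fin n →₀ ℕ) (f : MvPowerSeries (Fin n) ℂ) : MvPowerSeries (Fin n) ℂ :=
  fun m => MvPowerSeries.coeff (m + e) f

@[simp] theorem coeff_shift {n : ℕ} (e m : Fin n →₀ ℕ) (f : MvPowerSeries (Fin n) ℂ) :
    MvPowerSeries.coeff m (shift e f) = MvPowerSeries.coeff (m + e) f := rfl

theorem wnorm_shift_mul_le {n : ℕ} (w : Fin n → ℝ≥0∞) (e : Fin n →₀ ℕ)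
    (f : MvPowerSeries (Fin n) ℂ) : wnorm w (shift e f) * wmon w e ≤ wnorm w f := by
  rw [wnorm, ← ENNReal.tsum_mul_right]
  simp_rw [coeff_shift, mul_assoc, ← wmon_add]
  exact ENNReal.tsum_comp_le_tsum_of_injective (add_left_injective e)
    (fun m => ‖MvPowerSeries.coeff m f‖ₑ * wmon w m)

theorem wnorm_shift_le {n : ℕ} {w : Fin n → ℝ≥0∞} (hw : ∀ i, w i ≠ 0) (hw' : ∀ i, w i ≠ ∞)
    (e : Fin n →₀ ℕ) (f : MvPowerSeries (Fin n) ℂ) :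
    wnorm w (shift e f) ≤ wnorm w f / wmon w e := by
  rw [ENNReal.le_div_iff_mul_le (Or.inl (wmon_ne_zero hw e)) (Or.inl (wmon_ne_top hw' e))]
  exact wnorm_shift_mul_le w e f

theorem wnorm_shift_mul_contract {n : ℕ} {w : Fin n → ℝ≥0∞} (hw : ∀ i, w i ≠ 0)
    (hw' : ∀ i, w i ≠ ∞) (e : Fin n →₀ ℕ) (g u : MvPowerSeries (Fin n) ℂ) :
    wnorm w (shift e (g * u)) ≤ wnorm w g / wmon w e * wnorm w u := by
  refine (wnorm_shift_le hw hw' e _).trans ?_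
  rw [ENNReal.mul_div_right_comm.symm]
  exact ENNReal.div_le_div_right (wnorm_mul_le w g u) _

/-- The fixed point equation `q = f + shift e (g q)` has a solution when `g` is small. -/
theorem exists_eq_add_shift_mul {n : ℕ} {w : Fin n → ℝ≥0∞} (hw : ∀ i, w i ≠ 0)
    (hw' : ∀ i, w i ≠ ∞) (e : Fin n →₀ ℕ) {f g : MvPowerSeries (Fin n) ℂ}
    (hf : wnorm w f ≠ ∞) (hg : wnorm w g < wmon w e) :
    ∃ q, wnorm w q ≠ ∞ ∧ q = f + shift e (g * q) := by
  classical
  set θ := wnorm w g / wmon w e with hθ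
  have hθ1 : θ < 1 := by
    rw [hθ, ENNReal.div_lt_iff (Or.inl (wmon_ne_zero hw e)) (Or.inl (wmon_ne_top hw' e)), one_mul]
    exact hg
  -- The terms of the Neumann series whose sum is the solution `q`; their norms decay geometrically
  -- with ratio `θ`.
  obtain ⟨s, hs0, hs1⟩ : ∃ s : ℕ → MvPowerSeries (Fin n) ℂ,
      s 0 = f ∧ ∀ k, s (k + 1) = shift e (g * s k) :=
    ⟨fun k => (fun u => shift e (g * u))^[k] f, rfl,
      fun k => Function.iterate_succ_apply' (fun u => shift e (g * u)) k f⟩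
  have hbound : ∀ k, wnorm w (s k) ≤ θ ^ k * wnorm w f := by
    intro k
    induction k with
    | zero => simp [hs0]
    | succ k ih =>
      rw [hs1, pow_succ', mul_assoc]
      exact (wnorm_shift_mul_contract hw hw' e g _).trans (by gcongr)
  have hfin : ∑' k, wnorm w (s k) ≠ ∞ := by
    refine ne_top_of_le_ne_top ?_ (ENNReal.tsum_le_tsum hbound)
    rw [ENNReal.tsum_mul_right, ENNReal.tsum_geometric]
    exact ENNReal.mul_ne_top (ENNReal.inv_ne_top.mpr (tsub_pos_of_lt hθ1).ne') hf
  have hsum : ∀ m, Summable fun k => MvPowerSeries.coeff m (s k) := by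
    intro m
    have h1 : ∑' k, ‖MvPowerSeries.coeff m (s k)‖ₑ ≠ ∞ := by
      have h2 : (∑' k, ‖MvPowerSeries.coeff m (s k)‖ₑ) * wmon w m ≠ ∞ := by
        rw [← ENNReal.tsum_mul_right]
        exact ne_top_of_le_ne_top hfin (ENNReal.tsum_le_tsum fun k => le_wnorm w _ m)
      intro h3
      rw [h3, ENNReal.top_mul (wmon_ne_zero hw m)] at h2
      exact h2 rfl
    exact Summable.of_nnnorm (ENNReal.tsum_coe_ne_top_iff_summable.mp h1)
  obtain ⟨q, hq⟩ : ∃ q : MvPowerSeries (Fin n) ℂ,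
      ∀ m, MvPowerSeries.coeff m q = ∑' k, MvPowerSeries.coeff m (s k) :=
    ⟨fun m => ∑' k, MvPowerSeries.coeff m (s k), fun _ => rfl⟩
  refine ⟨q, ?_, ?_⟩
  · refine ne_top_of_le_ne_top hfin ?_
    simp only [wnorm]
    rw [ENNReal.tsum_comm]
    refine ENNReal.tsum_le_tsum fun m => ?_
    rw [ENNReal.tsum_mul_right, hq]
    gcongr
    exact enorm_tsum_le_tsum_enorm
  · ext m
    rw [map_add, coeff_shift, MvPowerSeries.coeff_mul, hq, (hsum m).tsum_eq_zero_add, hs0]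
    congr 1
    simp_rw [hs1, coeff_shift, MvPowerSeries.coeff_mul, hq]
    have hsum' : ∀ p ∈ Finset.HasAntidiagonal.antidiagonal (m + e), Summable fun k =>
        MvPowerSeries.coeff p.1 g * MvPowerSeries.coeff p.2 (s k) := fun p _ =>
      Summable.mul_left (MvPowerSeries.coeff p.1 g) (hsum p.2)
    rw [Summable.tsum_finsetSum hsum']
    simp_rw [tsum_mul_left]

/-- The map `u ↦ shift e (g u)` strictly decreases every finite nonzero norm. This yields uniqueness
in Weierstrass division. -/
theorem eq_zero_of_eq_shift_mul {n : ℕ} {w : Fin n → ℝ≥0∞} (hw : ∀ i, w i ≠ 0)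
    (hw' : ∀ i, w i ≠ ∞) (e : Fin n →₀ ℕ) {g q : MvPowerSeries (Fin n) ℂ}
    (hg : wnorm w g < wmon w e) (hq : wnorm w q ≠ ∞) (h : q = shift e (g * q)) : q = 0 := by
  have hθ1 : wnorm w g / wmon w e < 1 := by
    rw [ENNReal.div_lt_iff (Or.inl (wmon_ne_zero hw e)) (Or.inl (wmon_ne_top hw' e)), one_mul]
    exact hg
  have h1 := wnorm_shift_mul_contract hw hw' e g q
  rw [← h] at h1
  apply eq_zero_of_wnorm_eq_zero hw
  by_contra h0
  refine absurd h1 (not_le.mpr ?_)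
  calc _ < 1 * wnorm w q := (ENNReal.mul_lt_mul_iff_left h0 hq).mpr hθ1
    _ = _ := one_mul _

/-! ### Units -/

/-- Writing `f = c (1 - g)`, the inverse is `c⁻¹ q` with `q = 1 + g q`: the contraction principle
with `e = 0`. -/
theorem exists_isConvergent_mul_eq_one {n : ℕ} {f : MvPowerSeries (Fin n) ℂ} (hf : IsConvergent f)
    (h0 : MvPowerSeries.constantCoeff f ≠ 0) : ∃ q, IsConvergent q ∧ f * q = 1 := by
  set c := MvPowerSeries.constantCoeff f with hc
  set g : MvPowerSeries (Fin n) ℂ := 1 - MvPowerSeries.C c⁻¹ * f with hgdef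
  have hgc : IsConvergent g := by
    have : g = 1 + MvPowerSeries.C (-c⁻¹) * f := by rw [hgdef, map_neg]; ring
    rw [this]
    exact (by simpa using isConvergent_C (n := n) 1 : IsConvergent 1).add ((isConvergent_C _).mul hf)
  have hg0 : MvPowerSeries.coeff 0 g = 0 := by
    simp [hgdef, ← hc, h0]
  obtain ⟨r, hr, hgr⟩ := isConvergent_iff.mp hgc
  -- Since `g` has no constant term, shrinking the polyradius by `t` brings its norm below one.
  have hex : ∃ t : ℝ≥0, 0 < t ∧ (t : ℝ≥0∞) ≤ 1 ∧ t * wnorm (fun _ => (r : ℝ≥0∞)) g < 1 := by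
    obtain ⟨t, ht, ht'⟩ := ENNReal.exists_nnreal_pos_mul_lt hgr one_ne_zero
    refine ⟨min t 1, lt_min ht one_pos, by simp, lt_of_le_of_lt ?_ ht'⟩
    gcongr
    exact min_le_left _ _
  obtain ⟨t, ht, ht1, htg⟩ := hex
  have hw0 : ∀ i : Fin n, ((t : ℝ≥0∞) * r) ≠ 0 := by
    intro _; exact mul_ne_zero (by exact_mod_cast ht.ne') (by exact_mod_cast hr.ne')
  have hlt : wnorm (fun _ : Fin n => (t : ℝ≥0∞) * r) g < wmon (fun _ : Fin n => (t : ℝ≥0∞) * r) 0 := by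
    rw [wmon_zero]
    refine lt_of_le_of_lt (wnorm_scale_le Set.univ (fun i => ?_) (fun i _ => le_rfl) ?_) htg
    · exact mul_le_of_le_one_left' ht1
    · intro m hm
      by_contra hcon
      push Not at hcon
      have : m = 0 := by ext i; exact hcon i trivial
      exact hm (this ▸ hg0)
  obtain ⟨q, hq, hqe⟩ := exists_eq_add_shift_mul (f := 1) hw0
    (fun _ => ENNReal.mul_ne_top ENNReal.coe_ne_top ENNReal.coe_ne_top) 0 (by simp [wnorm_one]) hlt
  have hsh : shift 0 (g * q) = g * q := by ext m; simp
  rw [hsh] at hqe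
  refine ⟨MvPowerSeries.C c⁻¹ * q, (isConvergent_C _).mul (isConvergent_of_wnorm hw0 hq), ?_⟩
  have h1 : (1 - g) * q = 1 := by linear_combination hqe
  rw [← h1, hgdef]
  ring

theorem isUnit_of_constantCoeff_ne_zero {n : ℕ} {f : OS n}
    (h0 : MvPowerSeries.constantCoeff (toSeries n f) ≠ 0) : IsUnit f := by
  obtain ⟨q, hq, hfq⟩ := exists_isConvergent_mul_eq_one f.2 h0
  exact IsUnit.of_mul_eq_one (⟨q, hq⟩ : convergentSubalgebra n) (toSeries_injective n hfq)

/-! ### Substitution and convergence -/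

open MvPowerSeries in
theorem wnorm_subst_le {n k : ℕ} (w : Fin k → ℝ≥0∞) {a : Fin n → MvPowerSeries (Fin k) ℂ}
    (ha : HasSubst a) (f : MvPowerSeries (Fin n) ℂ) :
    wnorm w (subst a f) ≤ wnorm (fun i => wnorm w (a i)) f := by
  calc wnorm w (subst a f)
      ≤ ∑' e, ∑' d, ‖coeff d f‖ₑ * (‖coeff e (d.prod fun s j => a s ^ j)‖ₑ * wmon w e) := by
        refine ENNReal.tsum_le_tsum fun e => ?_
        rw [coeff_subst ha, ← tsum_eq_finsum (L := .unconditional _) (coeff_subst_finite ha f e)]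
        simp_rw [← mul_assoc]
        rw [ENNReal.tsum_mul_right]
        gcongr
        refine enorm_tsum_le_tsum_enorm.trans (le_of_eq (tsum_congr fun d => ?_))
        rw [smul_eq_mul, enorm_mul]
    _ = ∑' d, ‖coeff d f‖ₑ * wnorm w (d.prod fun s j => a s ^ j) := by
        rw [ENNReal.tsum_comm]
        simp_rw [ENNReal.tsum_mul_left]
        rfl
    _ ≤ _ := by
        refine ENNReal.tsum_le_tsum fun d => ?_
        gcongr
        rw [Finsupp.prod_fintype _ _ (by simp)]
        exact (wnorm_prod_le _ _ _).trans (Finset.prod_le_prod' fun i _ => wnorm_pow_le _ _ _)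

open MvPowerSeries in
/-- Substitution of power series of norm `O(r)` preserves convergence. -/
theorem IsConvergent.subst {n k : ℕ} {a : Fin n → MvPowerSeries (Fin k) ℂ} (ha : HasSubst a)
    {K : ℝ≥0} (hK : ∀ (r : ℝ≥0) (i), wnorm (fun _ => (r : ℝ≥0∞)) (a i) ≤ K * r)
    {f : MvPowerSeries (Fin n) ℂ} (hf : IsConvergent f) : IsConvergent (subst a f) := by
  obtain ⟨r, hr, hfr⟩ := isConvergent_iff.mp hf
  refine isConvergent_iff.mpr ⟨r / (K + 1), by positivity, ne_top_of_le_ne_top hfr ?_⟩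
  refine (wnorm_subst_le _ ha f).trans (wnorm_mono (fun i => (hK _ i).trans ?_) f)
  rw [← ENNReal.coe_mul, ENNReal.coe_le_coe, mul_div_left_comm]
  refine mul_le_of_le_one_right' ?_
  rw [div_le_one (by positivity)]
  simp

theorem wnorm_X {n : ℕ} (w : Fin n → ℝ≥0∞) (i : Fin n) :
    wnorm w (MvPowerSeries.X i) = w i := by
  rw [MvPowerSeries.X, wnorm_monomial, wmon, Finset.prod_eq_single i]
  · simp
  · intro j _ hj
    simp [hj.symm]
  · simp

theorem isConvergent_X {n : ℕ} (i : Fin n) :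
    IsConvergent (MvPowerSeries.X i : MvPowerSeries (Fin n) ℂ) :=
  isConvergent_iff.mpr ⟨1, one_pos, by rw [wnorm_X]; simp⟩

/-- The coordinate function `xᵢ`. -/
def coordOS {n : ℕ} (i : Fin n) : OS n := (⟨_, isConvergent_X i⟩ : convergentSubalgebra n)

@[simp] theorem toSeries_coordOS {n : ℕ} (i : Fin n) :
    toSeries n (coordOS i) = MvPowerSeries.X i := rfl

theorem isConvergent_rename {n : ℕ} {f : MvPowerSeries (Fin n) ℂ} (hf : IsConvergent f) :
    IsConvergent (MvPowerSeries.rename (Fin.succEmb n) f) := by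
  rw [MvPowerSeries.rename_eq_subst]
  refine IsConvergent.subst (K := 1) (MvPowerSeries.hasSubst_of_constantCoeff_zero (by simp)) ?_ hf
  intro r i
  simp [wnorm_X]

/-! ### Splitting off the first variable -/

/-- The inclusion of functions of `x₂, …, xₙ₊₁` into functions of `x₁, …, xₙ₊₁`. -/
def inclOS (n : ℕ) : OS n →ₐ[ℂ] OS (n + 1) :=
  ((MvPowerSeries.rename (R := ℂ) (Fin.succEmb n)).comp (convergentSubalgebra n).val).codRestrict
    (convergentSubalgebra (n + 1)) fun f => isConvergent_rename f.2

theorem toSeries_inclOS {n : ℕ} (f : OS n) :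
    toSeries (n + 1) (inclOS n f) = MvPowerSeries.rename (Fin.succEmb n) (toSeries n f) := rfl

theorem embDomain_succEmb {n : ℕ} (m : Fin n →₀ ℕ) :
    m.embDomain (Fin.succEmb n) = m.cons 0 := by
  ext i
  refine Fin.cases ?_ (fun j => ?_) i
  · rw [Finsupp.cons_zero, Finsupp.embDomain_of_notMem_range]
    rintro ⟨j, hj⟩
    exact Fin.succ_ne_zero j hj
  · rw [Finsupp.cons_succ]
    exact Finsupp.embDomain_apply_self (Fin.succEmb n) m j

theorem coeff_cons_inclOS {n : ℕ} (f : OS n) (k : ℕ) (m : Fin n →₀ ℕ) :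
    MvPowerSeries.coeff (m.cons k) (toSeries (n + 1) (inclOS n f)) =
      if k = 0 then MvPowerSeries.coeff m (toSeries n f) else 0 := by
  rw [toSeries_inclOS]
  split_ifs with hk
  · rw [hk, ← embDomain_succEmb, MvPowerSeries.coeff_embDomain_rename]
  · apply MvPowerSeries.coeff_rename_eq_zero
    rintro ⟨m', hm'⟩
    apply hk
    have := DFunLike.congr_fun hm' 0
    rw [Finsupp.cons_zero] at this
    rw [← this]
    apply Finsupp.mapDomain_of_notMem_range
    rintro ⟨j, hj⟩
    exact Fin.succ_ne_zero j hj

theorem cons_add_single {n : ℕ} (m : Fin n →₀ ℕ) (k d : ℕ) :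
    m.cons k + Finsupp.single 0 d = m.cons (k + d) := by
  ext i
  refine Fin.cases ?_ (fun j => ?_) i <;> simp [Fin.succ_ne_zero]

theorem coeff_X_pow_mul_cons {n : ℕ} (f : MvPowerSeries (Fin (n + 1)) ℂ) (j k : ℕ)
    (m : Fin n →₀ ℕ) :
    MvPowerSeries.coeff (m.cons k) (MvPowerSeries.X 0 ^ j * f) =
      if j ≤ k then MvPowerSeries.coeff (m.cons (k - j)) f else 0 := by
  classical
  rw [MvPowerSeries.X_pow_eq, MvPowerSeries.coeff_monomial_mul]
  have h1 : Finsupp.single 0 j ≤ m.cons k ↔ j ≤ k := by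
    rw [Finsupp.single_le_iff, Finsupp.cons_zero]
  simp only [h1, one_mul]
  split_ifs with h
  · congr 2
    rw [← Nat.sub_add_cancel h, ← cons_add_single, add_tsub_cancel_right, Nat.add_sub_cancel]
  · rfl

open Polynomial in
/-- The coefficients of the power series `∑ rₖ yᵏ`. -/
theorem coeff_cons_eval₂ {n : ℕ} (p : (OS n)[X]) (k : ℕ) (m : Fin n →₀ ℕ) :
    MvPowerSeries.coeff (m.cons k)
        (toSeries (n + 1) (p.eval₂ (inclOS n : OS n →+* OS (n + 1)) (coordOS 0))) =
      MvPowerSeries.coeff m (toSeries n (p.coeff k)) := by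
  induction p using Polynomial.induction_on' with
  | add p q hp hq => rw [eval₂_add, map_add, map_add, hp, hq, coeff_add, map_add, map_add]
  | monomial j a =>
    rw [eval₂_monomial, map_mul, map_pow, toSeries_coordOS, mul_comm, coeff_X_pow_mul_cons,
      coeff_monomial, RingHom.coe_coe]
    simp only [coeff_cons_inclOS]
    by_cases h : j = k
    · simp [h]
    · rw [if_neg h, map_zero, map_zero]
      split_ifs <;> first | rfl | omega

/-- The coefficient of `x₁ᵏ` of a power series in `x₁, …, xₙ₊₁`. -/
def sliceSeries {n : ℕ} (k : ℕ) (f : MvPowerSeries (Fin (n + 1)) ℂ) : MvPowerSeries (Fin n) ℂ :=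
  fun m => MvPowerSeries.coeff (m.cons k) f

theorem IsConvergent.slice {n : ℕ} (k : ℕ) {f : MvPowerSeries (Fin (n + 1)) ℂ}
    (hf : IsConvergent f) : IsConvergent (sliceSeries k f) := by
  obtain ⟨r, hr, hfr⟩ := isConvergent_iff.mp hf
  refine isConvergent_iff.mpr ⟨r, hr, fun htop => ?_⟩
  have hinj : Function.Injective fun m : Fin n →₀ ℕ => m.cons k := fun a b hab =>
    (Finsupp.cons_injective2 hab).2
  have h1 := ENNReal.tsum_comp_le_tsum_of_injective hinj fun m =>
    ‖MvPowerSeries.coeff m f‖ₑ * wmon (fun _ => (r : ℝ≥0∞)) m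
  have h2 : ∀ m : Fin n →₀ ℕ, wmon (fun _ => (r : ℝ≥0∞)) (m.cons k) =
      wmon (fun _ => (r : ℝ≥0∞)) m * r ^ k := by
    intro m
    simp [wmon, Fin.prod_univ_succ, mul_comm]
  simp_rw [h2, ← mul_assoc] at h1
  rw [ENNReal.tsum_mul_right] at h1
  refine hfr (top_le_iff.mp (le_trans (le_of_eq ?_) h1))
  change ∞ = wnorm (fun _ => (r : ℝ≥0∞)) (sliceSeries k f) * _
  rw [htop, ENNReal.top_mul]
  exact pow_ne_zero _ (by exact_mod_cast hr.ne')

/-- The coefficient of `x₁ᵏ` as an element of `𝒪` in one variable less. -/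
def sliceOS {n : ℕ} (k : ℕ) (f : OS (n + 1)) : OS n :=
  (⟨sliceSeries k (toSeries (n + 1) f), IsConvergent.slice k f.2⟩ : convergentSubalgebra n)

@[simp] theorem coeff_sliceOS {n : ℕ} (k : ℕ) (f : OS (n + 1)) (m : Fin n →₀ ℕ) :
    MvPowerSeries.coeff m (toSeries n (sliceOS k f)) =
      MvPowerSeries.coeff (m.cons k) (toSeries (n + 1) f) := rfl

theorem ext_cons {n : ℕ} {f g : OS (n + 1)} (h : ∀ (k : ℕ) (m : Fin n →₀ ℕ),
    MvPowerSeries.coeff (m.cons k) (toSeries (n + 1) f) =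
      MvPowerSeries.coeff (m.cons k) (toSeries (n + 1) g)) : f = g := by
  apply toSeries_injective
  ext m
  rw [← Finsupp.cons_tail m]
  exact h _ _

/-! ### Weierstrass division -/

/-- A power series `g` vanishing on the axis `x₂ = ⋯ = 0` has small norm for suitable weights. -/
theorem exists_weights {n : ℕ} (d : ℕ) {f g : MvPowerSeries (Fin (n + 1)) ℂ}
    (hf : IsConvergent f) (hg : IsConvergent g)
    (hg0 : ∀ k, MvPowerSeries.coeff (Finsupp.single 0 k) g = 0) :
    ∃ w : Fin (n + 1) → ℝ≥0∞, (∀ i, w i ≠ 0) ∧ (∀ i, w i ≠ ∞) ∧ wnorm w f ≠ ∞ ∧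
      wnorm w g < wmon w (Finsupp.single 0 d) := by
  obtain ⟨r₁, hr₁, hf⟩ := isConvergent_iff.mp hf
  obtain ⟨r₂, hr₂, hg⟩ := isConvergent_iff.mp hg
  set r := min r₁ r₂ with hr
  have hr0 : 0 < r := lt_min hr₁ hr₂
  replace hf : wnorm (fun _ => (r : ℝ≥0∞)) f ≠ ∞ :=
    ne_top_of_le_ne_top hf (wnorm_mono (fun _ => by exact_mod_cast min_le_left _ _) f)
  replace hg : wnorm (fun _ => (r : ℝ≥0∞)) g ≠ ∞ :=
    ne_top_of_le_ne_top hg (wnorm_mono (fun _ => by exact_mod_cast min_le_right _ _) g)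
  have hr0' : (r : ℝ≥0∞) ≠ 0 := by exact_mod_cast hr0.ne'
  obtain ⟨t', ht', htg'⟩ := ENNReal.exists_nnreal_pos_mul_lt hg (pow_ne_zero d hr0')
  set t := min t' 1 with htdef
  have ht : 0 < t := lt_min ht' one_pos
  have ht1 : (t : ℝ≥0∞) ≤ 1 := by exact_mod_cast min_le_right _ _
  have htg : t * wnorm (fun _ => (r : ℝ≥0∞)) g < (r : ℝ≥0∞) ^ d := by
    refine lt_of_le_of_lt ?_ htg'
    gcongr
    exact min_le_left _ _
  let w : Fin (n + 1) → ℝ≥0∞ := Fin.cons r fun _ => t * r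
  have hw0 : w 0 = r := rfl
  have hws : ∀ i : Fin n, w i.succ = t * r := fun _ => rfl
  have hle : ∀ i, w i ≤ r := Fin.cases le_rfl fun i => by
    rw [hws]; exact mul_le_of_le_one_left' ht1
  have hne : ∀ i, w i ≠ 0 := Fin.cases hr0' fun i =>
    mul_ne_zero (by exact_mod_cast ht.ne') hr0'
  refine ⟨w, hne, fun i => ?_, ?_, ?_⟩
  · exact ne_top_of_le_ne_top ENNReal.coe_ne_top (hle i)
  · exact ne_top_of_le_ne_top hf (wnorm_mono hle f)
  · have h1 : wmon w (Finsupp.single 0 d) = (r : ℝ≥0∞) ^ d := by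
      rw [wmon, Fin.prod_univ_succ, hw0]
      simp
    rw [h1]
    refine lt_of_le_of_lt (wnorm_scale_le (Set.range Fin.succ) hle ?_ ?_) htg
    · rintro _ ⟨i, rfl⟩
      rw [hws]
    · intro m hm
      by_contra hcon
      push Not at hcon
      apply hm
      rw [← hg0 (m 0)]
      congr 2
      ext i
      refine Fin.cases ?_ (fun j => ?_) i
      · simp
      · rw [hcon _ ⟨j, rfl⟩]
        simp [Fin.succ_ne_zero]

theorem eq_single_of_le_single {n : ℕ} {a : Fin (n + 1) →₀ ℕ} {d : ℕ}
    (h : a ≤ Finsupp.single 0 d) : a = Finsupp.single 0 (a 0) := by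
  ext i
  have := h i
  refine Fin.cases (fun _ => by simp) (fun j hj => ?_) i this
  rw [Finsupp.single_apply, if_neg (Fin.succ_ne_zero j).symm] at hj ⊢
  omega

/-- If a sum of exponents lies on the `x₁`-axis, so do both summands; vanishing on the axis is
therefore stable under multiplication. -/
theorem coeff_single_mul_eq_zero {n : ℕ} {g : MvPowerSeries (Fin (n + 1)) ℂ}
    (hg0 : ∀ k, MvPowerSeries.coeff (Finsupp.single 0 k) g = 0)
    (u : MvPowerSeries (Fin (n + 1)) ℂ) (k : ℕ) :
    MvPowerSeries.coeff (Finsupp.single 0 k) (g * u) = 0 := by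
  classical
  rw [MvPowerSeries.coeff_mul]
  refine Finset.sum_eq_zero fun p hp => ?_
  have hp' := Finset.HasAntidiagonal.mem_antidiagonal.mp hp
  rw [eq_single_of_le_single (a := p.1) (d := k) (hp' ▸ self_le_add_right _ _), hg0, zero_mul]

open Polynomial in
/-- `R / h` is `A[X] / P`, with `X` acting as `y`, where `P` is monic. -/
structure IsWeierstrass {A R : Type*} [CommRing A] [CommRing R] (ι : A →+* R) (y h : R)
    (P : A[X]) : Prop where
  monic : P.Monic
  associated : Associated (P.eval₂ ι y) h
  exists_remainder : ∀ f : R, ∃ r : A[X], r.degree < P.degree ∧ h ∣ f - r.eval₂ ι y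
  eq_zero : ∀ r : A[X], r.degree < P.degree → h ∣ r.eval₂ ι y → r = 0

theorem IsWeierstrass.of_associated {A R : Type*} [CommRing A] [CommRing R] {ι : A →+* R}
    {y h h' : R} {P : Polynomial A} (hh : Associated h h') (H : IsWeierstrass ι y h P) :
    IsWeierstrass ι y h' P where
  monic := H.monic
  associated := H.associated.trans hh
  exists_remainder f := by
    obtain ⟨r, hr, hd⟩ := H.exists_remainder f
    exact ⟨r, hr, hh.symm.dvd.trans hd⟩
  eq_zero r hr hd := H.eq_zero r hr (hh.dvd.trans hd)

theorem IsWeierstrass.map {A R S : Type*} [CommRing A] [CommRing R] [CommRing S] {ι : A →+* R}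
    {y h : R} {P : Polynomial A} (e : R ≃+* S) (H : IsWeierstrass ι y h P) :
    IsWeierstrass ((e : R →+* S).comp ι) (e y) (e h) P where
  monic := H.monic
  associated := by
    have := H.associated.map (e : R →+* S)
    rwa [RingHom.coe_coe, ← RingHom.coe_coe, Polynomial.hom_eval₂] at this
  exists_remainder f := by
    obtain ⟨r, hr, hd⟩ := H.exists_remainder (e.symm f)
    refine ⟨r, hr, ?_⟩
    have := map_dvd e hd
    rw [map_sub, e.apply_symm_apply] at this
    rwa [← RingHom.coe_coe e, Polynomial.hom_eval₂] at this
  eq_zero r hr hd := by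
    refine H.eq_zero r hr ?_
    have := map_dvd e.symm hd
    rw [e.symm_apply_apply] at this
    convert this
    rw [e.eq_symm_apply, ← RingHom.coe_coe e, Polynomial.hom_eval₂]

-- In `f = q (x₁ᵈ - g) + r`, the requirement that `r` have degree `< d` in `x₁` is the fixed point
-- equation `q = shift f + shift (g q)`. As `g` vanishes on the `x₁`-axis, suitable weights make it
-- a contraction.
open Polynomial in
theorem exists_isWeierstrass_sub {n : ℕ} (d : ℕ) (g : OS (n + 1))
    (hg0 : ∀ k, MvPowerSeries.coeff (Finsupp.single 0 k) (toSeries (n + 1) g) = 0) :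
    ∃ P, IsWeierstrass (inclOS n : OS n →+* OS (n + 1)) (coordOS 0) (coordOS 0 ^ d - g) P := by
  set ι : OS n →+* OS (n + 1) := (inclOS n : OS n →+* OS (n + 1)) with hι
  set e : Fin (n + 1) →₀ ℕ := Finsupp.single 0 d with he
  have coeffX : ∀ u : MvPowerSeries (Fin (n + 1)) ℂ, shift e (MvPowerSeries.X 0 ^ d * u) = u := by
    intro u
    ext m
    rw [← Finsupp.cons_tail m, coeff_shift, he, cons_add_single, coeff_X_pow_mul_cons,
      if_pos (by omega), Nat.add_sub_cancel]
  have shift_sub : ∀ u v, shift e (u - v) = shift e u - shift e v := fun u v => by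
    ext m; simp
  -- division with remainder
  have div : ∀ f : OS (n + 1), ∃ (q : OS (n + 1)) (r : (OS n)[X]), r.degree < d ∧
      f = q * (coordOS 0 ^ d - g) + r.eval₂ ι (coordOS 0) ∧
      toSeries (n + 1) q = shift e (toSeries (n + 1) f) +
        shift e (toSeries (n + 1) g * toSeries (n + 1) q) := by
    intro f
    obtain ⟨w, hw, hw', hfw, hgw⟩ := exists_weights d f.2 g.2 hg0
    have hsf : wnorm w (shift e (toSeries (n + 1) f)) ≠ ∞ :=
      ne_top_of_le_ne_top (ENNReal.div_ne_top hfw (wmon_ne_zero hw e)) (wnorm_shift_le hw hw' e _)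
    obtain ⟨q, hq, hqe⟩ := exists_eq_add_shift_mul hw hw' e hsf hgw
    obtain ⟨Q, rfl⟩ : ∃ Q : OS (n + 1), toSeries (n + 1) Q = q :=
      ⟨(⟨q, isConvergent_of_wnorm hw hq⟩ : convergentSubalgebra (n + 1)), rfl⟩
    -- The slices of order `< d` form the remainder; the higher ones vanish by the fixed point
    -- equation.
    let r : (OS n)[X] := ∑ k ∈ Finset.range d,
      monomial k (sliceOS k (f - Q * (coordOS 0 ^ d - g)))
    have hr : ∀ k, r.coeff k =
        if k < d then sliceOS k (f - Q * (coordOS 0 ^ d - g)) else 0 := by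
      intro k
      simp only [r, finsetSum_coeff, coeff_monomial, Finset.sum_ite_eq', Finset.mem_range]
    refine ⟨Q, r, ?_, ?_, hqe⟩
    · rw [degree_lt_iff_coeff_zero]
      intro k hk
      rw [hr, if_neg (by omega)]
    · rw [← sub_eq_iff_eq_add']
      apply ext_cons
      intro k m
      rw [coeff_cons_eval₂, hr]
      split_ifs with hk
      · rw [coeff_sliceOS]
      · have h1 : shift e (toSeries (n + 1) (f - Q * (coordOS 0 ^ d - g))) = 0 := by
          have : toSeries (n + 1) (f - Q * (coordOS 0 ^ d - g)) = toSeries (n + 1) f -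
              (MvPowerSeries.X 0 ^ d * toSeries (n + 1) Q -
                toSeries (n + 1) g * toSeries (n + 1) Q) := by
            simp only [map_sub, map_mul, map_pow, toSeries_coordOS]; ring
          rw [this, shift_sub, shift_sub, coeffX]
          rw [sub_sub_eq_add_sub, sub_eq_zero]
          exact hqe.symm
        have h2 := congrArg (MvPowerSeries.coeff (m.cons (k - d))) h1
        rw [coeff_shift, he, cons_add_single, Nat.sub_add_cancel (by omega)] at h2
        rw [h2]
        simp
  -- Preparation from division: dividing `x₁ᵈ` itself exhibits `X ^ d - r` as the Weierstrass
  -- polynomial.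
  obtain ⟨q, r, hr, hqr, hqe⟩ := div (coordOS 0 ^ d)
  have hPd : (X ^ d - r : (OS n)[X]).degree = (d : WithBot ℕ) := by
    rw [degree_sub_eq_left_of_degree_lt (by rwa [degree_X_pow]), degree_X_pow]
  have hPe : (X ^ d - r).eval₂ ι (coordOS 0) = q * (coordOS 0 ^ d - g) := by
    rw [eval₂_sub, eval₂_pow, eval₂_X, ← sub_eq_iff_eq_add.mpr hqr]
  refine ⟨X ^ d - r, ?_, ?_, ?_, ?_⟩
  · exact monic_X_pow_sub hr
  · rw [hPe]
    -- The constant term of `q` is one: the shift of `x₁ᵈ` contributes one, and `g q` vanishes on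
    -- the axis.
    have hu : IsUnit q := by
      apply isUnit_of_constantCoeff_ne_zero
      rw [hqe, map_add, ← MvPowerSeries.coeff_zero_eq_constantCoeff_apply,
        ← MvPowerSeries.coeff_zero_eq_constantCoeff_apply, coeff_shift, coeff_shift, zero_add,
        he, coeff_single_mul_eq_zero hg0, map_pow, toSeries_coordOS,
        MvPowerSeries.X_pow_eq, MvPowerSeries.coeff_monomial_same]
      simp
    exact associated_unit_mul_left _ _ hu
  · intro f
    obtain ⟨q', r', hr', hqr', -⟩ := div f
    rw [hPd]
    exact ⟨r', hr', q', by rw [hqr']; ring⟩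
  · rw [hPd]
    rintro p hp ⟨Q, hQ⟩
    have h1 : shift e (toSeries (n + 1) (p.eval₂ ι (coordOS 0))) = 0 := by
      ext m
      rw [← Finsupp.cons_tail m, coeff_shift, he, cons_add_single, coeff_cons_eval₂,
        (degree_lt_iff_coeff_zero _ _).mp hp _ (by omega)]
      simp
    have h2 : toSeries (n + 1) ((coordOS 0 ^ d - g) * Q) =
        MvPowerSeries.X 0 ^ d * toSeries (n + 1) Q - toSeries (n + 1) g * toSeries (n + 1) Q := by
      simp only [map_sub, map_mul, map_pow, toSeries_coordOS]; ring
    rw [hQ, h2, shift_sub, coeffX, sub_eq_zero] at h1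
    obtain ⟨w, hw, hw', hfw, hgw⟩ := exists_weights d Q.2 g.2 hg0
    have h3 : Q = 0 := toSeries_injective _ (by
      rw [map_zero]; exact eq_zero_of_eq_shift_mul hw hw' e hgw hfw h1)
    rw [h3, mul_zero] at hQ
    ext k
    apply toSeries_injective
    ext m
    rw [← coeff_cons_eval₂, ← hι, hQ]
    simp

open Polynomial in
/-- Weierstrass division and preparation for `h` regular in `x₁`. -/
theorem exists_isWeierstrass {n : ℕ} (h : OS (n + 1))
    (hreg : ∃ d, MvPowerSeries.coeff (Finsupp.single 0 d) (toSeries (n + 1) h) ≠ 0) :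
    ∃ P, IsWeierstrass (inclOS n : OS n →+* OS (n + 1)) (coordOS 0) h P := by
  classical
  set d := Nat.find hreg with hd
  have hd1 : MvPowerSeries.coeff (Finsupp.single 0 d) (toSeries (n + 1) h) ≠ 0 := Nat.find_spec hreg
  have hd2 : ∀ k < d, MvPowerSeries.coeff (Finsupp.single 0 k) (toSeries (n + 1) h) = 0 :=
    fun k hk => not_not.mp (Nat.find_min hreg hk)
  -- The choice `g = 0` is a dummy: only weights giving `h` finite norm are needed.
  obtain ⟨w, hw, hw', hfw, -⟩ := exists_weights 0 h.2 (g := 0)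
    (by simpa using isConvergent_C (n := n + 1) 0) (by simp)
  -- `x₁ᵈ E` is the part of `h` divisible by `x₁ᵈ`; the constant term of `E` is the leading
  -- coefficient of `h` on the axis.
  obtain ⟨E, hE⟩ : ∃ E : OS (n + 1), toSeries (n + 1) E =
      shift (Finsupp.single 0 d) (toSeries (n + 1) h) :=
    ⟨(⟨_, isConvergent_of_wnorm hw (ne_top_of_le_ne_top
      (ENNReal.div_ne_top hfw (wmon_ne_zero hw (Finsupp.single 0 d)))
      (wnorm_shift_le hw hw' _ _))⟩ : convergentSubalgebra (n + 1)), rfl⟩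
  have hEu : IsUnit E := by
    apply isUnit_of_constantCoeff_ne_zero
    rw [hE, ← MvPowerSeries.coeff_zero_eq_constantCoeff_apply, coeff_shift, zero_add]
    exact hd1
  obtain ⟨u, rfl⟩ := hEu
  -- By minimality of `d`, `h` and `x₁ᵈ E` agree on the axis. So `g` vanishes there, and `u⁻¹ h =
  -- x₁ᵈ - g` with `u = E`.
  set g : OS (n + 1) := coordOS 0 ^ d - (↑u⁻¹ : OS (n + 1)) * h with hg
  have hg' : g = (coordOS 0 ^ d * (u : OS (n + 1)) - h) * (↑u⁻¹ : OS (n + 1)) := by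
    rw [hg, sub_mul, mul_assoc, Units.mul_inv, mul_one, mul_comm h]
  have single_eq : ∀ k, (Finsupp.single 0 k : Fin (n + 1) →₀ ℕ) = (0 : Fin n →₀ ℕ).cons k := by
    intro k
    rw [Finsupp.cons_zero_eq_single_zero]
  obtain ⟨P, hP⟩ := exists_isWeierstrass_sub d g (by
    intro k
    rw [hg', map_mul]
    apply coeff_single_mul_eq_zero
    intro k
    rw [map_sub, map_sub, map_mul, map_pow, toSeries_coordOS, hE, single_eq, coeff_X_pow_mul_cons]
    split_ifs with hk
    · rw [coeff_shift, cons_add_single, Nat.sub_add_cancel hk, sub_self]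
    · rw [← single_eq, hd2 k (by omega), sub_zero])
  refine ⟨P, hP.of_associated ?_⟩
  rw [hg, sub_sub_cancel]
  exact (associated_unit_mul_left _ _ (Units.isUnit _))

/-! ### Chain rule for constant vector fields -/

section Chain

open MvPowerSeries MvPowerSeries.WithPiTopology in
theorem continuous_pderiv {σ R : Type*} [CommRing R] [TopologicalSpace R] [DiscreteTopology R]
    (i : σ) : Continuous (pderiv R i : MvPowerSeries σ R → MvPowerSeries σ R) := by
  refine continuous_pi fun m => ?_
  change Continuous fun f : MvPowerSeries σ R => coeff m (pderiv R i f)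
  simp_rw [coeff_pderiv]
  exact (continuous_of_discreteTopology (f := fun x : R => x * ((m i : R) + 1))).comp
    (continuous_coeff R _)

open MvPowerSeries MvPowerSeries.WithPiTopology in
/-- A vector field with constant coefficients killing all `aᵢ` kills every power series
in the `aᵢ`. -/
theorem sum_smul_pderiv_subst_eq_zero {σ τ R : Type*} [CommRing R] [Fintype τ]
    {a : σ → MvPowerSeries τ R} (ha : HasSubst a) (b : τ → R)
    (hb : ∀ i, ∑ t, b t • pderiv R t (a i) = 0) (f : MvPowerSeries σ R) :
    ∑ t, b t • pderiv R t (subst a f) = 0 := by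
  -- With discrete coefficients, polynomials are dense and both sides are continuous, so checking
  -- polynomials suffices.
  let _ : UniformSpace R := ⊥
  have _ : DiscreteUniformity R := ⟨rfl⟩
  have hpoly : ∀ p : MvPolynomial σ R,
      ∑ t, b t • pderiv R t (subst a (p : MvPowerSeries σ R)) = 0 := by
    intro p
    rw [subst_coe]
    induction p using MvPolynomial.induction_on with
    | C r => simp
    | add p q hp hq => simp only [map_add, smul_add, Finset.sum_add_distrib, hp, hq, add_zero]
    | mul_X p i hp =>
      simp only [map_mul, MvPolynomial.aeval_X, Derivation.leibniz, smul_add,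
        Finset.sum_add_distrib, smul_comm (b _), ← Finset.smul_sum, hp, hb, smul_zero, add_zero]
  have h1 : Continuous fun f : MvPowerSeries σ R => ∑ t, b t • pderiv R t (subst a f) :=
    continuous_finsetSum _ fun t _ => Continuous.const_smul
      (g := fun f : MvPowerSeries σ R => pderiv R t (subst a f))
      ((continuous_pderiv t).comp (continuous_subst ha)) (b t)
  have h2 := (denseRange_toMvPowerSeries (σ := σ) (R := R)).equalizer h1
    (continuous_const (y := 0)) (funext hpoly)
  exact congrFun h2 f

end Chain

/-! ### Shears and directional derivatives -/

/-- The linear forms `x₁, xᵢ + cᵢ x₁`. -/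
def shearVec {n : ℕ} (c : Fin n → ℂ) : Fin (n + 1) → MvPowerSeries (Fin (n + 1)) ℂ :=
  Fin.cons (MvPowerSeries.X 0) fun i =>
    MvPowerSeries.X i.succ + MvPowerSeries.C (c i) * MvPowerSeries.X 0

@[simp] theorem shearVec_zero {n : ℕ} (c : Fin n → ℂ) :
    shearVec c 0 = MvPowerSeries.X 0 := rfl

@[simp] theorem shearVec_succ {n : ℕ} (c : Fin n → ℂ) (i : Fin n) :
    shearVec c i.succ = MvPowerSeries.X i.succ + MvPowerSeries.C (c i) * MvPowerSeries.X 0 := rfl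

theorem hasSubst_shearVec {n : ℕ} (c : Fin n → ℂ) : MvPowerSeries.HasSubst (shearVec c) :=
  MvPowerSeries.hasSubst_of_constantCoeff_zero (Fin.cases (by simp) (by simp))

theorem wnorm_shearVec_le {n : ℕ} (c : Fin n → ℂ) (r : ℝ≥0) (i : Fin (n + 1)) :
    wnorm (fun _ => (r : ℝ≥0∞)) (shearVec c i) ≤ ((1 + ∑ j, ‖c j‖₊ : ℝ≥0) : ℝ≥0∞) * r := by
  refine Fin.cases ?_ (fun j => ?_) i
  · rw [shearVec_zero, wnorm_X]
    refine le_mul_of_one_le_left' ?_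
    norm_cast
    exact le_self_add
  · rw [shearVec_succ]
    refine (wnorm_add_le _ _ _).trans ?_
    rw [wnorm_X]
    refine (add_le_add_right (wnorm_mul_le _ _ _) _).trans ?_
    rw [wnorm_C, wnorm_X, ENNReal.coe_add, add_mul, ENNReal.coe_one, one_mul]
    gcongr
    rw [enorm_eq_nnnorm]
    norm_cast
    exact Finset.single_le_sum (f := fun j => ‖c j‖₊) (fun _ _ => zero_le) (Finset.mem_univ j)

/-- The linear change of coordinates `xᵢ ↦ xᵢ + cᵢ x₁`. -/
def shearHom {n : ℕ} (c : Fin n → ℂ) : OS (n + 1) →ₐ[ℂ] OS (n + 1) :=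
  ((MvPowerSeries.substAlgHom (hasSubst_shearVec c)).comp
    (convergentSubalgebra (n + 1)).val).codRestrict (convergentSubalgebra (n + 1)) fun f => by
      rw [AlgHom.comp_apply, MvPowerSeries.substAlgHom_apply]
      exact IsConvergent.subst (hasSubst_shearVec c) (wnorm_shearVec_le c) f.2

theorem toSeries_shearHom {n : ℕ} (c : Fin n → ℂ) (f : OS (n + 1)) :
    toSeries (n + 1) (shearHom c f) = MvPowerSeries.subst (shearVec c) (toSeries (n + 1) f) :=
  MvPowerSeries.substAlgHom_apply (hasSubst_shearVec c) _

open MvPowerSeries in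
theorem shearHom_neg_apply {n : ℕ} (c : Fin n → ℂ) (f : OS (n + 1)) :
    shearHom (-c) (shearHom c f) = f := by
  apply toSeries_injective
  rw [toSeries_shearHom, toSeries_shearHom,
    subst_comp_subst_apply (hasSubst_shearVec c) (hasSubst_shearVec (-c))]
  have : (fun s => subst (shearVec (-c)) (shearVec c s)) = X := by
    funext i
    refine Fin.cases ?_ (fun j => ?_) i
    · rw [shearVec_zero, subst_X (hasSubst_shearVec (-c)), shearVec_zero]
    · rw [shearVec_succ, subst_add (hasSubst_shearVec (-c)), subst_mul (hasSubst_shearVec (-c)),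
        subst_X (hasSubst_shearVec (-c)), subst_X (hasSubst_shearVec (-c)), subst_C,
        shearVec_zero, shearVec_succ, Pi.neg_apply, map_neg]
      ring
  rw [this, subst_self, id]

/-- `shearHom` as an automorphism. -/
def shearEquiv {n : ℕ} (c : Fin n → ℂ) : OS (n + 1) ≃ₐ[ℂ] OS (n + 1) :=
  AlgEquiv.ofAlgHom (shearHom c) (shearHom (-c))
    (AlgHom.ext fun f => by simpa using shearHom_neg_apply (-c) f)
    (AlgHom.ext fun f => shearHom_neg_apply c f)

/-- Functions of the linear forms `xᵢ - cᵢ x₁`, `i ≥ 2`. -/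
def shearIncl {n : ℕ} (c : Fin n → ℂ) : OS n →+* OS (n + 1) :=
  ((shearHom (-c)).comp (inclOS n) : OS n →ₐ[ℂ] OS (n + 1))

open MvPowerSeries in
theorem toSeries_shearIncl {n : ℕ} (c : Fin n → ℂ) (f : OS n) :
    toSeries (n + 1) (shearIncl c f) =
      subst (fun i : Fin n => (X i.succ - C (c i) * X 0 : MvPowerSeries (Fin (n + 1)) ℂ))
        (toSeries n f) := by
  change toSeries (n + 1) (shearHom (-c) (inclOS n f)) = _
  rw [toSeries_shearHom, toSeries_inclOS, rename_eq_subst,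
    subst_comp_subst_apply _ (hasSubst_shearVec (-c))]
  · congr 1
    funext i
    rw [Function.comp_apply, subst_X (hasSubst_shearVec (-c)), Fin.coe_succEmb, shearVec_succ,
      Pi.neg_apply, map_neg]
    ring
  · exact hasSubst_of_constantCoeff_zero (by simp)

theorem shearHom_coordOS_zero {n : ℕ} (c : Fin n → ℂ) :
    shearHom c (coordOS 0) = coordOS 0 :=
  toSeries_injective _ (by
    rw [toSeries_shearHom, toSeries_coordOS, MvPowerSeries.subst_X (hasSubst_shearVec c),
      shearVec_zero])

/-- The directional derivative along `(1, c)`. -/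
def dirDeriv {n : ℕ} (c : Fin n → ℂ) (f : OS (n + 1)) : OS (n + 1) :=
  partialOS 0 f + ∑ i, c i • partialOS i.succ f

theorem toSeries_partialOS {n : ℕ} (i : Fin n) (f : OS n) :
    toSeries n (partialOS i f) = MvPowerSeries.pderiv ℂ i (toSeries n f) := rfl

theorem dirDeriv_add {n : ℕ} (c : Fin n → ℂ) (f g : OS (n + 1)) :
    dirDeriv c (f + g) = dirDeriv c f + dirDeriv c g := by
  simp only [dirDeriv, partialOS_add, smul_add, Finset.sum_add_distrib]
  ring

theorem dirDeriv_mul {n : ℕ} (c : Fin n → ℂ) (f g : OS (n + 1)) :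
    dirDeriv c (f * g) = f * dirDeriv c g + g * dirDeriv c f := by
  simp only [dirDeriv, partialOS_mul, smul_add, Finset.sum_add_distrib, mul_add, Finset.mul_sum,
    mul_smul_comm]
  ring

theorem dirDeriv_coordOS_zero {n : ℕ} (c : Fin n → ℂ) : dirDeriv c (coordOS 0) = 1 := by
  apply toSeries_injective
  rw [dirDeriv, map_add, map_sum, map_one, toSeries_partialOS, toSeries_coordOS,
    MvPowerSeries.pderiv_X_self, Finset.sum_eq_zero, add_zero]
  intro i _
  rw [map_smul, toSeries_partialOS, toSeries_coordOS,
    MvPowerSeries.pderiv_X_of_ne (Fin.succ_ne_zero i).symm, smul_zero]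

-- The forms `xᵢ - cᵢ x₁` are constant along `(1, c)`, hence so are all series in them.
open MvPowerSeries in
theorem dirDeriv_shearIncl {n : ℕ} (c : Fin n → ℂ) (f : OS n) :
    dirDeriv c (shearIncl c f) = 0 := by
  classical
  have h := sum_smul_pderiv_subst_eq_zero
    (a := fun i : Fin n => (X i.succ - C (c i) * X 0 : MvPowerSeries (Fin (n + 1)) ℂ))
    (hasSubst_of_constantCoeff_zero (by simp)) (Fin.cons 1 c : Fin (n + 1) → ℂ) (fun i => by
      simp [Fin.sum_univ_succ, pderiv_X, Fin.succ_ne_zero, Pi.single_apply,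
        (Fin.succ_ne_zero _).symm, smul_eq_C_mul]) (toSeries n f)
  rw [← toSeries_shearIncl, Fin.sum_univ_succ] at h
  apply toSeries_injective
  rw [dirDeriv, map_add, map_sum, map_zero]
  simp_rw [map_smul, toSeries_partialOS]
  simpa using h

/-! ### Generic coordinates are regular -/

/-- Restriction of a power series to the `x₁`-axis. -/
def axisHom (n : ℕ) : MvPowerSeries (Fin (n + 1)) ℂ →+* PowerSeries ℂ :=
  (PowerSeries.map MvPowerSeries.constantCoeff).comp
    (MvPowerSeries.finSuccEquiv ℂ n).toRingEquiv.toRingHom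

theorem coeff_axisHom {n : ℕ} (f : MvPowerSeries (Fin (n + 1)) ℂ) (k : ℕ) :
    PowerSeries.coeff k (axisHom n f) = MvPowerSeries.coeff (Finsupp.single 0 k) f := by
  rw [axisHom, RingHom.comp_apply, PowerSeries.coeff_map,
    ← MvPowerSeries.coeff_zero_eq_constantCoeff_apply, ← Finsupp.cons_zero_eq_single_zero]
  exact MvPowerSeries.coeff_coeff_finSuccEquiv ..

theorem axisHom_shearVec {n : ℕ} (c : Fin n → ℂ) (i : Fin (n + 1)) :
    axisHom n (shearVec c i) =
      PowerSeries.C ((Fin.cons 1 c : Fin (n + 1) → ℂ) i) * PowerSeries.X := by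
  classical
  ext k
  rw [coeff_axisHom, PowerSeries.coeff_C_mul, PowerSeries.coeff_X]
  have h0 : ∀ j : Fin n, (Finsupp.single 0 k : Fin (n + 1) →₀ ℕ) ≠ Finsupp.single j.succ 1 := by
    intro j hj
    have := DFunLike.congr_fun hj j.succ
    simp [Fin.succ_ne_zero] at this
  have h1 : (Finsupp.single 0 k : Fin (n + 1) →₀ ℕ) = Finsupp.single 0 1 ↔ k = 1 :=
    (Finsupp.single_injective 0).eq_iff
  refine Fin.cases ?_ (fun j => ?_) i
  · simp [MvPowerSeries.coeff_X, h1]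
  · simp [MvPowerSeries.coeff_X, h0, h1]

-- On the `x₁`-axis the sheared coordinates become `x₁` and `cᵢ x₁`, so only the homogeneous part of
-- degree `d` contributes, evaluated at `(1, c)`.
open MvPowerSeries in
theorem coeff_single_subst_shearVec {n : ℕ} (c : Fin n → ℂ) (f : MvPowerSeries (Fin (n + 1)) ℂ)
    (d : ℕ) : coeff (Finsupp.single 0 d) (subst (shearVec c) f) =
      ∑ m ∈ Finset.finsuppAntidiag Finset.univ d, coeff m f * ∏ i, c i ^ m i.succ := by
  classical
  have key : ∀ m : Fin (n + 1) →₀ ℕ,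
      coeff (Finsupp.single 0 d) (m.prod fun s j => shearVec c s ^ j) =
        if m.degree = d then ∏ i, c i ^ m i.succ else 0 := by
    intro m
    rw [← coeff_axisHom, Finsupp.prod_fintype _ _ (by simp), map_prod]
    simp_rw [map_pow, axisHom_shearVec, mul_pow]
    rw [Finset.prod_mul_distrib, Finset.prod_pow_eq_pow_sum, ← Finsupp.degree_eq_sum]
    simp_rw [← map_pow]
    rw [← map_prod, PowerSeries.coeff_C_mul, PowerSeries.coeff_X_pow, Fin.prod_univ_succ]
    simp [eq_comm]
  rw [coeff_subst (hasSubst_shearVec c)]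
  simp_rw [key]
  rw [finsum_eq_sum_of_support_subset (s := Finset.finsuppAntidiag Finset.univ d)]
  · refine Finset.sum_congr rfl fun m hm => ?_
    rw [Finset.mem_finsuppAntidiag] at hm
    rw [if_pos (by rw [Finsupp.degree_eq_sum]; exact hm.1), smul_eq_mul]
  · intro m hm
    rw [Finset.mem_coe, Finset.mem_finsuppAntidiag]
    refine ⟨?_, by simp⟩
    by_contra hne
    rw [← Finsupp.degree_eq_sum] at hne
    simp [hne] at hm

/-- For `c` in a non-empty Zariski open set, `h` is regular in the direction `(1, c)`. -/
theorem exists_generic {n : ℕ} {h : OS (n + 1)} (hne : h ≠ 0) :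
    ∃ G : MvPolynomial (Fin n) ℂ, G ≠ 0 ∧ ∀ c, MvPolynomial.eval c G ≠ 0 →
      ∃ P, IsWeierstrass (shearIncl c) (coordOS 0) h P := by
  classical
  obtain ⟨m₀, hm₀⟩ : ∃ m, MvPowerSeries.coeff m (toSeries (n + 1) h) ≠ 0 := by
    by_contra! hcon
    exact hne (toSeries_injective _ (by ext m; simpa using hcon m))
  -- Any degree in which `h` has a nonzero term works: `G(c)` is the homogeneous part of that degree
  -- at `(1, c)`.
  set d := m₀.degree with hd
  refine ⟨∑ m ∈ Finset.finsuppAntidiag Finset.univ d,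
    MvPolynomial.monomial m.tail (MvPowerSeries.coeff m (toSeries (n + 1) h)), fun h0 => ?_,
    fun c hc => ?_⟩
  · have h1 := congrArg (MvPolynomial.coeff m₀.tail) h0
    rw [MvPolynomial.coeff_sum, Finset.sum_eq_single m₀] at h1
    · simp [hm₀] at h1
    · intro m hm hne
      rw [MvPolynomial.coeff_monomial, if_neg]
      -- In fixed total degree the tail of an exponent determines its first entry, so no terms of
      -- `G` cancel.
      intro ht
      apply hne
      have h2 := (Finset.mem_finsuppAntidiag.mp hm).1
      rw [hd, Finsupp.degree_eq_sum, Fin.sum_univ_succ, Fin.sum_univ_succ] at h2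
      have h3 : ∀ i : Fin n, m i.succ = m₀ i.succ := fun i => DFunLike.congr_fun ht i
      simp_rw [h3] at h2
      ext i
      exact Fin.cases (by simpa using h2) h3 i
    · intro hm
      exact absurd (Finset.mem_finsuppAntidiag.mpr
        ⟨by rw [hd, Finsupp.degree_eq_sum], by simp⟩) hm
  · obtain ⟨P, hP⟩ := exists_isWeierstrass (shearHom c h) ⟨d, by
      rw [toSeries_shearHom, coeff_single_subst_shearVec]
      rw [map_sum] at hc
      convert hc using 3 with m
      rw [MvPolynomial.eval_monomial, Finsupp.prod_fintype _ _ (by simp)]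
      rfl⟩
    -- Transport back along the inverse shear, which fixes `x₁`.
    refine ⟨P, ?_⟩
    have := hP.map (shearEquiv (-c)).toRingEquiv
    have h1 : (shearEquiv (-c)).toRingEquiv (coordOS 0) = coordOS 0 := shearHom_coordOS_zero _
    have h2 : (shearEquiv (-c)).toRingEquiv (shearHom c h) = h := shearHom_neg_apply c h
    rw [h1, h2] at this
    exact this

open Polynomial

/-! ### Algebra of the quotient `R / h ≅ A[X] / P` -/

section Weierstrass

variable {A R : Type*} [CommRing A] [CommRing R] {ι : A →+* R} {y h : R} {P : A[X]}

/-- `p ↦ p(y)` modulo `h`. -/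
def quotientEval (ι : A →+* R) (y h : R) : A[X] →+* R ⧸ Ideal.span {h} :=
  (Ideal.Quotient.mk (Ideal.span {h})).comp (eval₂RingHom ι y)

theorem quotientEval_apply (p : A[X]) :
    quotientEval ι y h p = Ideal.Quotient.mk (Ideal.span {h}) (p.eval₂ ι y) := rfl

theorem IsWeierstrass.surjective (H : IsWeierstrass ι y h P) :
    Function.Surjective (quotientEval ι y h) := by
  intro b
  obtain ⟨f, rfl⟩ := Ideal.Quotient.mk_surjective b
  obtain ⟨r, -, hr⟩ := H.exists_remainder f
  refine ⟨r, ?_⟩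
  rw [quotientEval_apply, eq_comm, Ideal.Quotient.eq, Ideal.mem_span_singleton]
  exact hr

theorem IsWeierstrass.quotientEval_eq_zero_iff [Nontrivial A] (H : IsWeierstrass ι y h P)
    {p : A[X]} : quotientEval ι y h p = 0 ↔ P ∣ p := by
  rw [quotientEval_apply, Ideal.Quotient.eq_zero_iff_mem, Ideal.mem_span_singleton]
  constructor
  · intro hp
    rw [← modByMonic_eq_zero_iff_dvd H.monic]
    refine H.eq_zero _ (degree_modByMonic_lt _ H.monic) ?_
    rw [modByMonic_eq_sub_mul_div, eval₂_sub, eval₂_mul]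
    exact dvd_sub hp (H.associated.symm.dvd.trans (dvd_mul_right _ _))
  · rintro ⟨q, rfl⟩
    rw [eval₂_mul]
    exact H.associated.symm.dvd.trans (dvd_mul_right _ _)

theorem IsWeierstrass.isNoetherianRing_quotient [IsNoetherianRing A]
    (H : IsWeierstrass ι y h P) : IsNoetherianRing (R ⧸ Ideal.span {h}) :=
  isNoetherianRing_of_surjective _ _ _ H.surjective

/-- Monic factorizations of `P` give factorizations of `h` up to a unit, so `P` is irreducible,
hence prime as `A[X]` is factorial. Primality passes to `h` through `R / h ≅ A[X] / P`. -/
theorem IsWeierstrass.prime_of_irreducible [IsDomain A] [UniqueFactorizationMonoid A] [IsDomain R]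
    (H : IsWeierstrass ι y h P) (hh : Irreducible h) : Prime h := by
  -- If `f(y)` is a unit with `f` nonconstant, then `h` divides `g(y)` although `deg g < deg P`,
  -- against uniqueness of remainders.
  have key : ∀ f g : A[X], f.Monic → g.Monic → f * g = P →
      IsUnit (f.eval₂ ι y) → f.natDegree = 0 := by
    intro f g hf hg hfg hu
    by_contra hne
    have hdeg : g.degree < P.degree := by
      rw [← hfg, degree_mul, degree_eq_natDegree hf.ne_zero, degree_eq_natDegree hg.ne_zero]
      norm_cast
      omega
    refine hg.ne_zero (H.eq_zero g hdeg ?_)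
    have h1 := H.associated.symm.dvd
    rw [← hfg, eval₂_mul] at h1
    exact (hu.dvd_mul_left).mp h1
  have hirr : Irreducible P := by
    rw [H.monic.irreducible_iff_natDegree]
    refine ⟨?_, fun f g hf hg hfg => ?_⟩
    · rintro rfl
      have := H.associated
      rw [eval₂_one] at this
      exact hh.not_isUnit (this.isUnit isUnit_one)
    · have h1 : Irreducible (f.eval₂ ι y * g.eval₂ ι y) := by
        rw [← eval₂_mul, hfg]; exact H.associated.symm.irreducible hh
      rcases h1.isUnit_or_isUnit rfl with hu | hu
      · exact Or.inl (key f g hf hg hfg hu)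
      · exact Or.inr (key g f hg hf (by rw [mul_comm, hfg]) hu)
  have hprime := hirr.prime
  rw [← Ideal.span_singleton_prime hh.ne_zero, ← Ideal.Quotient.isDomain_iff_prime]
  have : Nontrivial (R ⧸ Ideal.span {h}) :=
    Ideal.Quotient.nontrivial_iff.mpr (by rw [Ne, Ideal.span_singleton_eq_top]; exact hh.not_isUnit)
  have : NoZeroDivisors (R ⧸ Ideal.span {h}) := ⟨fun {a b} hab => by
    obtain ⟨p, rfl⟩ := H.surjective a
    obtain ⟨q, rfl⟩ := H.surjective b
    rw [← map_mul, H.quotientEval_eq_zero_iff] at hab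
    rw [H.quotientEval_eq_zero_iff, H.quotientEval_eq_zero_iff]
    exact hprime.dvd_or_dvd hab⟩
  exact NoZeroDivisors.to_isDomain _

end Weierstrass

/-! ### Noetherianity and factoriality of `𝒪_S` -/

/-- For nonzero `h ∈ I`, the image of `I` modulo `h` is finitely generated, and the kernel of `I → R
/ h` is generated by `h`. -/
theorem isNoetherianRing_of_quotients {R : Type*} [CommRing R]
    (hR : ∀ h : R, h ≠ 0 → IsNoetherianRing (R ⧸ Ideal.span {h})) : IsNoetherianRing R := by
  rw [isNoetherianRing_iff_ideal_fg]
  intro I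
  by_cases hI : I = ⊥
  · rw [hI]; exact Submodule.fg_bot
  obtain ⟨h, hhI, hh⟩ := Submodule.exists_mem_ne_zero_of_ne_bot hI
  have := hR h hh
  have : IsNoetherian R (R ⧸ Ideal.span {h}) :=
    (LinearMap.isNoetherian_iff_of_bijective (σ := Ideal.Quotient.mk (Ideal.span {h}))
      (⟨AddHom.id _, fun _ _ => rfl⟩ :
        (R ⧸ Ideal.span {h}) →ₛₗ[Ideal.Quotient.mk (Ideal.span {h})] (R ⧸ Ideal.span {h}))
      Function.bijective_id).mpr this
  apply Submodule.fg_of_fg_map_of_fg_inf_ker (Ideal.span {h}).mkQ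
  · exact IsNoetherian.noetherian _
  · rw [Submodule.ker_mkQ, inf_eq_right.mpr ((Ideal.span_singleton_le_iff_mem I).mpr hhI)]
    exact ⟨{h}, by simp [Ideal.submodule_span_eq]⟩

theorem exists_weierstrass {n : ℕ} {h : OS (n + 1)} (hh : h ≠ 0) :
    ∃ c P, IsWeierstrass (shearIncl c) (coordOS 0) h P := by
  obtain ⟨G, hG, H⟩ := exists_generic hh
  obtain ⟨c, hc⟩ : ∃ c, MvPolynomial.eval c G ≠ 0 := by
    by_contra! hcon
    exact hG (MvPolynomial.funext fun c => by rw [hcon, map_zero])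
  exact ⟨c, H c hc⟩

theorem eq_zero_of_constantCoeff_eq_zero {f : OS 0}
    (hf : MvPowerSeries.constantCoeff (toSeries 0 f) = 0) : f = 0 := by
  apply toSeries_injective
  ext m
  rw [Subsingleton.elim m 0, MvPowerSeries.coeff_zero_eq_constantCoeff_apply, hf, map_zero,
    map_zero]

theorem isField_OS_zero : IsField (OS 0) where
  exists_pair_ne := ⟨0, 1, zero_ne_one⟩
  mul_comm := mul_comm
  mul_inv_cancel {f} hf := by
    have : IsUnit f := isUnit_of_constantCoeff_ne_zero
      fun h0 => hf (eq_zero_of_constantCoeff_eq_zero h0)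
    exact this.exists_right_inv

theorem isNoetherianRing_OS (n : ℕ) : IsNoetherianRing (OS n) := by
  induction n with
  | zero =>
    let _ := isField_OS_zero.toField
    infer_instance
  | succ n ih =>
    refine isNoetherianRing_of_quotients fun h hh => ?_
    obtain ⟨c, P, H⟩ := exists_weierstrass hh
    exact H.isNoetherianRing_quotient

instance (n : ℕ) : IsNoetherianRing (OS n) := isNoetherianRing_OS n

theorem uniqueFactorizationMonoid_OS (n : ℕ) : UniqueFactorizationMonoid (OS n) := by
  induction n with
  | zero =>
    let _ := isField_OS_zero.toField
    infer_instance
  | succ n ih =>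
    refine ⟨fun {h} => ⟨fun hh => ?_, Prime.irreducible⟩⟩
    obtain ⟨c, P, H⟩ := exists_weierstrass hh.ne_zero
    exact H.prime_of_irreducible hh

instance (n : ℕ) : UniqueFactorizationMonoid (OS n) := uniqueFactorizationMonoid_OS n

/-! ### Integral elements over a reduced quotient `A[X] / P` -/

section Hypersurface

variable {A B : Type*} [CommRing A] [CommRing B] [Algebra A B]
  {φ : A[X] →ₐ[A] B} {P : A[X]}

theorem exists_associated_map (x : (FractionRing A)[X]) :
    ∃ x₀ : A[X], Associated (x₀.map (algebraMap A (FractionRing A))) x := by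
  obtain ⟨b, hb, hx⟩ := IsLocalization.integerNormalization_spec A⁰ x
  have hu : IsUnit (C (algebraMap A (FractionRing A) b)) :=
    isUnit_C.mpr (IsLocalization.map_units (FractionRing A) (⟨b, hb⟩ : A⁰))
  refine ⟨IsLocalization.integerNormalization A⁰ x, ?_⟩
  rw [hx, ← algebraMap_smul (FractionRing A) b x, smul_eq_C_mul]
  exact associated_unit_mul_left _ _ hu

theorem map_fractionRing_dvd_iff (hP : P.Monic) {q : A[X]} :
    P.map (algebraMap A (FractionRing A)) ∣ q.map (algebraMap A (FractionRing A)) ↔ P ∣ q :=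
  map_dvd_map _ (IsFractionRing.injective A (FractionRing A)) hP

/-- If `P` divides a power of `x` over the fraction field, clearing denominators gives a nilpotent
of `B`, hence zero; so `P` is radical. -/
theorem squarefree_map_of_isReduced [IsDomain A] [IsReduced B] (hP : P.Monic) (hker : ∀ p, φ p = 0 ↔ P ∣ p) :
    Squarefree (P.map (algebraMap A (FractionRing A))) := by
  rw [← isRadical_iff_squarefree_of_ne_zero (hP.map _).ne_zero]
  intro k x hx
  obtain ⟨x₀, h₀⟩ := exists_associated_map x
  rw [← h₀.dvd_iff_dvd_right, map_fractionRing_dvd_iff hP, ← hker]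
  rw [← (h₀.pow_pow (n := k)).dvd_iff_dvd_right, ← Polynomial.map_pow, map_fractionRing_dvd_iff hP,
    ← hker, map_pow] at hx
  exact eq_zero_of_pow_eq_zero hx

/-- A common factor `g` of `P = g q` and `V` makes `V` kill the class of `q` after clearing
denominators. Conversely, coprimality lets `V` be cancelled from `P ∣ T V`. -/
theorem mem_nonZeroDivisors_iff_isCoprime [IsDomain A] (hP : P.Monic) (hφ : Function.Surjective φ)
    (hker : ∀ p, φ p = 0 ↔ P ∣ p) (V : A[X]) :
    φ V ∈ B⁰ ↔ IsCoprime (P.map (algebraMap A (FractionRing A)))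
      (V.map (algebraMap A (FractionRing A))) := by
  classical
  rw [mem_nonZeroDivisors_iff_right]
  constructor
  · intro hV
    rw [← EuclideanDomain.gcd_isUnit_iff]
    set g := EuclideanDomain.gcd (P.map (algebraMap A (FractionRing A)))
      (V.map (algebraMap A (FractionRing A)))
    obtain ⟨q, hq⟩ : g ∣ P.map (algebraMap A (FractionRing A)) := EuclideanDomain.gcd_dvd_left _ _
    obtain ⟨w, hw⟩ : g ∣ V.map (algebraMap A (FractionRing A)) := EuclideanDomain.gcd_dvd_right _ _
    obtain ⟨q₀, h₀⟩ := exists_associated_map q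
    have h1 : P ∣ q₀ * V := by
      rw [← map_fractionRing_dvd_iff hP, Polynomial.map_mul,
        (h₀.mul_right _).dvd_iff_dvd_right, hw, hq]
      exact ⟨w, by ring⟩
    rw [← hker, map_mul] at h1
    have h2 := hV _ h1
    rw [hker, ← map_fractionRing_dvd_iff hP, h₀.dvd_iff_dvd_right] at h2
    have hq0 : q ≠ 0 := by
      rintro rfl
      rw [mul_zero] at hq
      exact (hP.map _).ne_zero hq
    obtain ⟨r, hr⟩ := h2
    rw [hq] at hr
    refine IsUnit.of_mul_eq_one r (mul_left_cancel₀ hq0 ?_)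
    linear_combination -hr
  · intro hcop x hx
    obtain ⟨T, rfl⟩ := hφ x
    rw [← map_mul, hker, ← map_fractionRing_dvd_iff hP, Polynomial.map_mul] at hx
    rw [hker, ← map_fractionRing_dvd_iff hP]
    exact hcop.dvd_of_dvd_mul_right hx

theorem separable_map_of_isReduced [IsDomain A] [CharZero A] [IsReduced B] (hP : P.Monic)
    (hker : ∀ p, φ p = 0 ↔ P ∣ p) : (P.map (algebraMap A (FractionRing A))).Separable :=
  haveI : CharZero (FractionRing A) :=
    charZero_of_injective_algebraMap (IsFractionRing.injective A (FractionRing A))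
  PerfectField.separable_iff_squarefree.mpr (squarefree_map_of_isReduced hP hker)

theorem derivative_mem_nonZeroDivisors [IsDomain A] [CharZero A] [IsReduced B] (hP : P.Monic)
    (hφ : Function.Surjective φ) (hker : ∀ p, φ p = 0 ↔ P ∣ p) :
    φ (derivative P) ∈ B⁰ := by
  rw [mem_nonZeroDivisors_iff_isCoprime hP hφ hker, ← derivative_map]
  exact separable_map_of_isReduced hP hker

theorem algebra_isIntegral_of_monic (hP : P.Monic) (hφ : Function.Surjective φ)
    (hker : ∀ p, φ p = 0 ↔ P ∣ p) : Algebra.IsIntegral A B := by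
  have hφX : ∀ p, aeval (φ X) p = φ p := fun p => by
    rw [Polynomial.aeval_algHom_apply, aeval_X_left_apply]
  have hX : IsIntegral A (φ X) :=
    ⟨P, hP, by rw [← aeval_def, hφX, hker]⟩
  refine ⟨fun b => ?_⟩
  obtain ⟨p, rfl⟩ := hφ b
  rw [← hφX]
  exact (Algebra.adjoin_le (S := integralClosure A B) (Set.singleton_subset_iff.mpr hX))
    (aeval_mem_adjoin_singleton A _)

variable {Q : Type*} [CommRing Q] [Algebra B Q] [IsLocalization B⁰ Q] [Algebra A Q]
  [IsScalarTower A B Q]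

/-- The values of an integral element of the total ring of fractions at the roots of `P`
are integral. -/
theorem isIntegral_value_of_isIntegral [IsDomain A] (hP : P.Monic) (hφ : Function.Surjective φ)
    (hker : ∀ p, φ p = 0 ↔ P ∣ p) {E : Type*} [Field E] [Algebra A E] [Algebra (FractionRing A) E]
    [IsScalarTower A (FractionRing A) E] {f : Q} (hf : IsIntegral B f) {U V : A[X]}
    (hV : φ V ∈ B⁰) (hfUV : f * algebraMap B Q (φ V) = algebraMap B Q (φ U)) {α : E}
    (hα : aeval α P = 0) : IsIntegral A (aeval α U / aeval α V) := by
  let L : A[X] ⧸ RingHom.ker φ →ₐ[A] E := Ideal.Quotient.liftₐ (RingHom.ker φ) (aeval α : A[X] →ₐ[A] E) (by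
    intro p hp
    obtain ⟨q, rfl⟩ := (hker p).mp hp
    rw [map_mul, hα, zero_mul])
  let ψ : B →ₐ[A] E := L.comp (Ideal.quotientKerAlgEquivOfSurjective hφ).symm.toAlgHom
  have hψ : ∀ p, ψ (φ p) = aeval α p := fun p => by
    have h1 : (Ideal.quotientKerAlgEquivOfSurjective hφ).symm (φ p) =
        Ideal.Quotient.mk (RingHom.ker φ) p := by
      rw [AlgEquiv.symm_apply_eq]
      rfl
    change L ((Ideal.quotientKerAlgEquivOfSurjective hφ).symm (φ p)) = _
    rw [h1]
    rfl
  -- A nonzerodivisor is coprime to `P` over the fraction field, so it cannot vanish at the root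
  -- `α`; evaluation at `α` thus extends to `Q`.
  have hunit : ∀ v : B⁰, IsUnit (ψ v) := by
    rintro ⟨v, hv⟩
    obtain ⟨T, rfl⟩ := hφ v
    rw [mem_nonZeroDivisors_iff_isCoprime hP hφ hker] at hv
    rw [isUnit_iff_ne_zero, hψ]
    intro h0
    have h1 := hv.map (aeval α : (FractionRing A)[X] →ₐ[FractionRing A] E).toRingHom
    simp only [AlgHom.toRingHom_eq_coe, RingHom.coe_coe] at h1
    rw [aeval_map_algebraMap, aeval_map_algebraMap, h0, hα] at h1
    exact not_isCoprime_zero_zero h1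
  let Ψ : Q →ₐ[A] E :=
    { IsLocalization.lift (M := B⁰) (g := (ψ : B →+* E)) hunit with
      commutes' := fun a => by
        rw [IsScalarTower.algebraMap_apply A B Q]
        exact (IsLocalization.lift_eq (M := B⁰) hunit _).trans (ψ.commutes a) }
  have hΨ : ∀ b, Ψ (algebraMap B Q b) = ψ b := fun b => IsLocalization.lift_eq (M := B⁰) hunit b
  have := algebra_isIntegral_of_monic hP hφ hker
  have hint : IsIntegral A (Ψ f) := (isIntegral_trans f hf).map Ψ
  have hV0 : aeval α V ≠ 0 := by
    rw [← hψ]; exact (hunit ⟨_, hV⟩).ne_zero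
  have h1 := congrArg Ψ hfUV
  rw [map_mul, hΨ, hΨ, hψ, hψ] at h1
  rwa [← h1, mul_div_cancel_right₀ _ hV0]

/-- Multiplication by the derivative of `P` maps the normalization of `A[X] / P` into
`A[X] / P`. -/
theorem exists_derivative_mul_eq [IsDomain A] [IsIntegrallyClosed A] [CharZero A] [IsReduced B] (hP : P.Monic)
    (hφ : Function.Surjective φ) (hker : ∀ p, φ p = 0 ↔ P ∣ p) {f : Q} (hf : IsIntegral B f) :
    ∃ b : B, algebraMap B Q (φ (derivative P)) * f = algebraMap B Q b := by
  classical
  obtain ⟨⟨u, v, hv⟩, hfuv⟩ := IsLocalization.surj B⁰ f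
  obtain ⟨U, rfl⟩ := hφ u
  obtain ⟨V, rfl⟩ := hφ v
  simp only at hfuv
  set K := FractionRing A
  set E := AlgebraicClosure K
  have hsep := separable_map_of_isReduced hP hker
  -- `W` inverts `V` modulo `P` over `K`, so `W U P'` represents `P' f`; `R` below is its remainder.
  obtain ⟨a, W, haW⟩ := (mem_nonZeroDivisors_iff_isCoprime hP hφ hker V).mp hv
  set PK := P.map (algebraMap A K) with hPK
  have hPKm : PK.Monic := hP.map _
  set R : K[X] := (W * U.map (algebraMap A K) * derivative PK) %ₘ PK with hR
  obtain ⟨s, hs⟩ := exists_finset_of_splits (algebraMap K E) hsep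
    (IsAlgClosed.splits _)
  rw [hPKm.leadingCoeff, map_one, C_1, one_mul] at hs
  have hroot : ∀ α ∈ s, aeval α P = 0 := by
    intro α hα
    rw [← aeval_map_algebraMap K, ← eval_map_algebraMap, hs, eval_prod]
    exact Finset.prod_eq_zero hα (by simp)
  let F : E → E := fun α => aeval α U / aeval α V
  have hF : ∀ α ∈ s, IsIntegral A (F α) := fun α hα =>
    isIntegral_value_of_isIntegral hP hφ hker hf hv hfuv (hroot α hα)
  -- Lagrange interpolation without denominators: `G(α) = F(α) P'(α)`, with visibly integral
  -- coefficients.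
  let G : E[X] := ∑ α ∈ s, C (F α) * ∏ β ∈ s.erase α, (X - C β)
  have hGint : ∀ k, IsIntegral A (G.coeff k) := by
    have hC : ∀ x : E, IsIntegral A x → C x ∈ lifts (algebraMap (integralClosure A E) E) :=
      fun x hx => C_mem_lifts (algebraMap (integralClosure A E) E) ⟨x, hx⟩
    have hG : G ∈ lifts (algebraMap (integralClosure A E) E) := by
      refine sum_mem fun α hα => mul_mem (hC _ (hF α hα)) (prod_mem fun β hβ => ?_)
      rw [sub_eq_add_neg, ← C_neg]
      exact add_mem (X_mem_lifts _)
        (hC _ (IsIntegral.neg ⟨P, hP, hroot β (Finset.mem_of_mem_erase hβ)⟩))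
    intro k
    obtain ⟨x, hx⟩ := (lifts_iff_coeff_lifts G).mp hG k
    rw [← hx]
    exact x.2
  have heval : ∀ α ∈ s, ∀ f : E → E,
      eval α (∑ γ ∈ s, C (f γ) * ∏ β ∈ s.erase γ, (X - C β)) =
        f α * eval α (∏ β ∈ s.erase α, (X - C β)) := by
    intro α hα f
    rw [eval_finsetSum, Finset.sum_eq_single_of_mem α hα, eval_mul, eval_C]
    intro γ _ hne
    rw [eval_mul, eval_prod, Finset.prod_eq_zero (i := α), mul_zero]
    · exact Finset.mem_erase.mpr ⟨hne.symm, hα⟩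
    · simp
  have hRG : R.map (algebraMap K E) = G := by
    have hdeg : (PK.map (algebraMap K E)).degree = s.card := by
      rw [hs, degree_prod]; simp
    refine eq_of_degrees_lt_of_eval_finset_eq s ?_ ?_ fun α hα => ?_
    · rw [← hdeg, degree_map, degree_map]
      exact degree_modByMonic_lt _ hPKm
    · refine (degree_sum_le _ _).trans_lt ?_
      rw [Finset.sup_lt_iff (by exact WithBot.bot_lt_coe _)]
      intro α hα
      rw [← smul_eq_C_mul]
      refine (degree_smul_le _ _).trans_lt ?_
      rw [degree_prod]
      simp only [degree_X_sub_C, Finset.sum_const, nsmul_eq_mul, mul_one]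
      rw [Finset.card_erase_of_mem hα]
      exact_mod_cast Nat.sub_lt (Finset.card_pos.mpr ⟨α, hα⟩) one_pos
    · rw [heval α hα]
      have hPα : aeval α PK = 0 := by rw [hPK, aeval_map_algebraMap, hroot α hα]
      -- Product rule for `P = ∏ (X - β)`: only the summand omitting `α` survives at `α`.
      have h1 : eval α (∏ β ∈ s.erase α, (X - C β)) = aeval α (derivative PK) := by
        rw [← eval_map_algebraMap, ← derivative_map, hs, derivative_prod_finset]
        simpa using (heval α hα fun _ => 1).symm
      have h2 : aeval α W * aeval α V = 1 := by
        have := congrArg (aeval α) haW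
        rwa [map_add, map_mul, map_mul, hPα, mul_zero, zero_add, aeval_map_algebraMap,
          map_one] at this
      rw [h1, eval_map_algebraMap, hR, aeval_modByMonic_eq_self_of_root hPα, map_mul, map_mul,
        aeval_map_algebraMap]
      congr 1
      rw [eq_div_iff (right_ne_zero_of_mul_eq_one h2)]
      linear_combination aeval α U * h2
  -- The coefficients of `R` lie in `K` and are integral over `A`, which is integrally closed.
  have hRint : ∀ k, ∃ r : A, algebraMap A K r = R.coeff k := by
    intro k
    apply IsIntegrallyClosed.isIntegral_iff.mp
    rw [← isIntegral_algebraMap_iff (algebraMap K E).injective, ← coeff_map, hRG]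
    exact hGint k
  obtain ⟨R₀, hR₀⟩ : ∃ R₀ : A[X], R₀.map (algebraMap A K) = R := by
    rw [← Polynomial.mem_lifts, lifts_iff_coeff_lifts]
    exact hRint
  -- Modulo `P`, `R V ≡ W U P' V ≡ P' U`; divisibility by a monic polynomial descends to `A`.
  have hdvd : P ∣ derivative P * U - R₀ * V := by
    rw [← map_fractionRing_dvd_iff hP, Polynomial.map_sub, Polynomial.map_mul, Polynomial.map_mul,
      hR₀, ← derivative_map, ← hPK]
    have h1 := modByMonic_add_div (W * U.map (algebraMap A K) * derivative PK) PK
    rw [← hR] at h1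
    refine ⟨derivative PK * U.map (algebraMap A K) * a +
      ((W * U.map (algebraMap A K) * derivative PK) /ₘ PK) * V.map (algebraMap A K), ?_⟩
    linear_combination -(derivative PK * U.map (algebraMap A K)) * haW
      - V.map (algebraMap A K) * h1
  refine ⟨φ R₀, ?_⟩
  rw [← hker, map_sub, map_mul, map_mul, sub_eq_zero] at hdvd
  apply (IsLocalization.map_units Q (⟨φ V, hv⟩ : B⁰)).mul_right_cancel
  rw [mul_assoc, hfuv, ← map_mul (algebraMap B Q), hdvd, map_mul]

end Hypersurface

/-! ### The derivative of `h` in a Weierstrass direction -/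

/-- The direction `(1, c)` kills the coefficients and sends `x₁` to one, so it acts as `d/dX`. -/
theorem dirDeriv_eval₂ {n : ℕ} (c : Fin n → ℂ) (p : (OS n)[X]) :
    dirDeriv c (p.eval₂ (shearIncl c) (coordOS 0)) =
      (derivative p).eval₂ (shearIncl c) (coordOS 0) := by
  have hpow : ∀ k : ℕ, dirDeriv c (coordOS 0 ^ k : OS (n + 1)) =
      (k : OS (n + 1)) * coordOS 0 ^ (k - 1) := by
    intro k
    induction k with
    | zero =>
      have := dirDeriv_mul c 1 1
      simp only [mul_one, one_mul] at this
      simpa using this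
    | succ k ih =>
      rw [pow_succ, dirDeriv_mul, ih, dirDeriv_coordOS_zero]
      rcases k with _ | k
      · simp
      · simp only [Nat.add_sub_cancel]; push_cast; ring
  induction p using Polynomial.induction_on' with
  | add p q hp hq => rw [eval₂_add, dirDeriv_add, hp, hq, derivative_add, eval₂_add]
  | monomial k a =>
    rw [eval₂_monomial, dirDeriv_mul, dirDeriv_shearIncl, hpow, derivative_monomial,
      eval₂_monomial, map_mul, map_natCast]
    ring

theorem toOD_eq_zero_iff {n : ℕ} {h f : OS n} : toOD h f = 0 ↔ h ∣ f := by
  rw [toOD, Ideal.Quotient.eq_zero_iff_mem, Ideal.mem_span_singleton]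

theorem algebraMap_MD_injective {n : ℕ} (h : OS n) :
    Function.Injective (algebraMap (OD h) (MD h)) :=
  IsLocalization.injective (MD h) le_rfl

theorem toMD_eq_iff {n : ℕ} {h f g : OS n} : toMD h f = toMD h g ↔ h ∣ f - g := by
  rw [← toOD_eq_zero_iff, map_sub, sub_eq_zero]
  exact (algebraMap_MD_injective h).eq_iff

instance (n : ℕ) : CharZero (OS n) :=
  charZero_of_injective_algebraMap (algebraMap ℂ (OS n)).injective

section Generic

variable {n : ℕ} {h : OS (n + 1)} {c : Fin n → ℂ} {P : (OS n)[X]}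

/-- The derivative of `h` along `(1, c)` is up to a unit the derivative of the Weierstrass
polynomial. -/
theorem IsWeierstrass.exists_toOD_dirDeriv
    (H : IsWeierstrass (shearIncl c) (coordOS 0) h P) :
    ∃ u : OS (n + 1), IsUnit u ∧ toOD h (dirDeriv c h) =
      toOD h u * quotientEval (shearIncl c) (coordOS 0) h (derivative P) := by
  obtain ⟨u, hu⟩ := H.associated
  refine ⟨u, u.isUnit, ?_⟩
  have h1 : toOD h (P.eval₂ (shearIncl c) (coordOS 0)) = 0 :=
    toOD_eq_zero_iff.mpr H.associated.symm.dvd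
  -- Leibniz rule for `h = P(x₁) u`; the first summand vanishes on `D`.
  have h2 : dirDeriv c h = P.eval₂ (shearIncl c) (coordOS 0) * dirDeriv c (u : OS (n + 1)) +
      u * (derivative P).eval₂ (shearIncl c) (coordOS 0) := by
    rw [← dirDeriv_eval₂, ← dirDeriv_mul, hu]
  rw [h2, map_add, map_mul, map_mul, h1, zero_mul, zero_add]
  rfl

theorem IsWeierstrass.toOD_dirDeriv [IsReduced (OD h)]
    (H : IsWeierstrass (shearIncl c) (coordOS 0) h P) :
    toOD h (dirDeriv c h) ∈ (OD h)⁰ ∧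
      ∀ f ∈ normalization h, toMD h (dirDeriv c h) * f ∈ idealToMD h ⊤ := by
  obtain ⟨u, hu, hD⟩ := H.exists_toOD_dirDeriv
  -- The base ring acts through the sheared inclusion, which puts `OD h` in the form `A[X] / P`.
  let _ : Algebra (OS n) (OD h) := ((toOD h).comp (shearIncl c)).toAlgebra
  let φ : (OS n)[X] →ₐ[OS n] OD h :=
    { quotientEval (shearIncl c) (coordOS 0) h with
      commutes' := fun a => congrArg (toOD h) (eval₂_C _ _) }
  have hφ : Function.Surjective φ := H.surjective
  have hker : ∀ p, φ p = 0 ↔ P ∣ p := fun p => H.quotientEval_eq_zero_iff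
  have hφ' : ∀ p, quotientEval (shearIncl c) (coordOS 0) h p = φ p := fun _ => rfl
  rw [hφ'] at hD
  refine ⟨?_, fun f hf => ?_⟩
  · rw [hD]
    exact mul_mem ((hu.map (toOD h)).mem_nonZeroDivisors)
      (derivative_mem_nonZeroDivisors H.monic hφ hker)
  · obtain ⟨b, hb⟩ := exists_derivative_mul_eq (Q := MD h) H.monic hφ hker
      (show IsIntegral (OD h) f from hf)
    refine ⟨toOD h u * b, trivial, ?_⟩
    change algebraMap (OD h) (MD h) (toOD h u * b) = algebraMap (OD h) (MD h) (toOD h (dirDeriv c h)) * f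
    rw [hD, map_mul, map_mul, mul_assoc, hb]

end Generic

/-! ### Partial derivatives as multipliers of the normalization -/

theorem mem_idealToMD_top {n : ℕ} {h : OS n} {x : MD h} :
    x ∈ idealToMD h ⊤ ↔ ∃ a : OS n, toMD h a = x := by
  constructor
  · rintro ⟨b, -, rfl⟩
    obtain ⟨a, rfl⟩ := Ideal.Quotient.mk_surjective b
    exact ⟨a, rfl⟩
  · rintro ⟨a, rfl⟩
    exact ⟨toOD h a, trivial, rfl⟩

theorem mem_dual {n : ℕ} {h : OS n} {I : Submodule (OD h) (MD h)} {x : MD h} :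
    x ∈ dual h I ↔ ∀ y ∈ I, x * y ∈ idealToMD h ⊤ :=
  Submodule.mem_div_iff_forall_mul_mem

/-- The functions on `S` whose restriction multiplies `f` into `𝒪_D`. -/
def multipliers {n : ℕ} (h : OS n) (f : MD h) : Ideal (OS n) where
  carrier := {x | toMD h x * f ∈ idealToMD h ⊤}
  zero_mem' := by simp
  add_mem' := by
    intro x y hx hy
    rw [Set.mem_ofPred_eq, map_add, add_mul]
    exact add_mem hx hy
  smul_mem' := by
    intro r x hx
    rw [Set.mem_ofPred_eq, smul_eq_mul, map_mul, mul_assoc]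
    have h1 := Submodule.smul_mem (idealToMD h ⊤) (toOD h r) hx
    rwa [Algebra.smul_def] at h1

theorem exists_mem_jacobianIdeal_nonZeroDivisors {n : ℕ} {h : OS (n + 1)} (hne : h ≠ 0)
    [IsReduced (OD h)] : ∃ x ∈ jacobianIdeal h, x ∈ (OD h)⁰ := by
  obtain ⟨c, P, H⟩ := exists_weierstrass hne
  refine ⟨_, ?_, H.toOD_dirDeriv.1⟩
  have hmem : ∀ i, toOD h (partialOS i h) ∈ jacobianIdeal h := fun i =>
    Ideal.subset_span ⟨i, rfl⟩
  rw [dirDeriv, map_add, map_sum]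
  refine add_mem (hmem 0) (sum_mem fun i _ => ?_)
  rw [Algebra.smul_def, map_mul]
  exact Ideal.mul_mem_left _ _ (hmem _)

/-- Multipliers form an ideal containing the derivatives of `h` in all generic directions;
differences of two such directions isolate each coordinate derivative. -/
theorem partialOS_mem_multipliers {n : ℕ} {h : OS (n + 1)} (hne : h ≠ 0) [IsReduced (OD h)]
    {f : MD h} (hf : f ∈ normalization h) (i : Fin (n + 1)) :
    partialOS i h ∈ multipliers h f := by
  classical
  obtain ⟨G, hG, H⟩ := exists_generic hne
  have hD : ∀ c, MvPolynomial.eval c G ≠ 0 → dirDeriv c h ∈ multipliers h f := by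
    intro c hc
    obtain ⟨P, hP⟩ := H c hc
    exact hP.toOD_dirDeriv.2 f hf
  obtain ⟨c, hc⟩ : ∃ c, MvPolynomial.eval c G ≠ 0 := by
    by_contra! hcon
    exact hG (MvPolynomial.funext fun c => by rw [hcon, map_zero])
  have hsucc : ∀ j : Fin n, partialOS j.succ h ∈ multipliers h f := by
    intro j
    -- Nonvanishing of `G` is open, so some `t ≠ 0` keeps `c + t eⱼ` generic.
    have hcont : Continuous fun t : ℂ => MvPolynomial.eval (c + Pi.single j t) G :=
      (MvPolynomial.continuous_eval G).comp
        (continuous_const.add (continuous_single (A := fun _ : Fin n => ℂ) j))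
    have hev : ∀ᶠ t in nhds (0 : ℂ), MvPolynomial.eval (c + Pi.single j t) G ≠ 0 :=
      hcont.continuousAt.eventually_ne (by simpa using hc)
    obtain ⟨t, ht, ht0⟩ := ((hev.filter_mono nhdsWithin_le_nhds).and
      (self_mem_nhdsWithin (s := {0}ᶜ))).exists
    have h1 : dirDeriv (c + Pi.single j t) h - dirDeriv c h = t • partialOS j.succ h := by
      simp only [dirDeriv, Pi.add_apply, add_smul, Finset.sum_add_distrib]
      rw [Finset.sum_eq_single_of_mem (s := Finset.univ) (a := j) (Finset.mem_univ j)
        (f := fun x => (Pi.single j t : Fin n → ℂ) x • partialOS x.succ h)]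
      · rw [Pi.single_eq_same]; ring
      · intro k _ hk
        rw [Pi.single_eq_of_ne hk, zero_smul]
    have h2 := sub_mem (hD _ ht) (hD c hc)
    rw [h1] at h2
    have h3 := (multipliers h f).mul_mem_left (algebraMap ℂ (OS (n + 1)) t⁻¹) h2
    rwa [← Algebra.smul_def, smul_smul, inv_mul_cancel₀ ht0, one_smul] at h3
  refine Fin.cases ?_ hsucc i
  have h1 : partialOS 0 h = dirDeriv c h - ∑ j, c j • partialOS j.succ h := by
    rw [dirDeriv, add_sub_cancel_right]
  rw [h1]
  refine sub_mem (hD c hc) (sum_mem fun j _ => ?_)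
  rw [Algebra.smul_def]
  exact Ideal.mul_mem_left _ _ (hsucc j)

/-! ### Residues are dual to the Jacobian ideal -/

/-- The form is `∑ (aᵢ / h) dxᵢ` with `aᵢ` lifting `∂ᵢh · f`. The congruence `g aᵢ ≡ ξ ∂ᵢh` modulo
`h` yields the residue `ξ / g`, and `aⱼ ∂ᵢh ≡ aᵢ ∂ⱼh` makes the pole of `dω` simple. -/
theorem mem_residues_of_forall {n : ℕ} {h : OS n} (hne : h ≠ 0) {f : MD h}
    (hf : ∀ i, partialOS i h ∈ multipliers h f) : f ∈ residues h := by
  choose a ha using fun i => mem_idealToMD_top.mp (hf i)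
  obtain ⟨⟨ξ', g', hg'⟩, hfg⟩ := IsLocalization.surj (OD h)⁰ f
  obtain ⟨ξ, rfl⟩ := Ideal.Quotient.mk_surjective ξ'
  obtain ⟨g, rfl⟩ := Ideal.Quotient.mk_surjective g'
  replace hfg : f * toMD h g = toMD h ξ := hfg
  have hhM : algebraMap (OS n) (MS n) h ≠ 0 := by simpa using hne
  have hb : ∀ i, ∃ b, g * a i - partialOS i h * ξ = h * b := by
    intro i
    refine toMD_eq_iff.mp ?_
    rw [map_mul, map_mul, ha, ← hfg]
    ring
  choose b hb using hb
  have he : ∀ i j, ∃ e, a j * partialOS i h - a i * partialOS j h = h * e := by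
    intro i j
    refine toMD_eq_iff.mp ?_
    rw [map_mul, map_mul, ha, ha]
    ring
  refine ⟨fun i => algebraMap (OS n) (MS n) (a i) / algebraMap (OS n) (MS n) h,
    ⟨fun i => ⟨a i, mul_div_cancel₀ _ hhM⟩, fun i j => ?_⟩, ξ, g, b, hg', fun i => ?_, hfg⟩
  · obtain ⟨e, he⟩ := he i j
    refine ⟨partialOS i (a j) - partialOS j (a i) - e, ?_⟩
    have he' := congrArg (algebraMap (OS n) (MS n)) he
    rw [extDeriv, partialMS_div _ _ _ hne, partialMS_div _ _ _ hne]
    simp only [map_sub, map_mul] at he' ⊢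
    field_simp
    linear_combination -he'
  · have hb' := congrArg (algebraMap (OS n) (MS n)) (hb i)
    simp only [map_sub, map_mul] at hb'
    field_simp
    linear_combination hb'

/-- With `aᵢ = h ωᵢ` holomorphic, the residue representation reads `g aᵢ ≡ ξ ∂ᵢh` modulo `h`, and
`g` cancels in `ℳ_D`. -/
theorem partialOS_mem_multipliers_of_mem_residues {n : ℕ} {h : OS n} (hne : h ≠ 0) {f : MD h}
    (hf : f ∈ residues h) (i : Fin n) : partialOS i h ∈ multipliers h f := by
  obtain ⟨ω, ⟨hω, -⟩, ξ, g, η, hg, hgω, hfg⟩ := hf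
  obtain ⟨a, ha⟩ := hω i
  have hhM : algebraMap (OS n) (MS n) h ≠ 0 := by simpa using hne
  have h1 : g * a - partialOS i h * ξ = h * η i := by
    apply IsFractionRing.injective (OS n) (MS n)
    have := hgω i
    simp only [map_sub, map_mul]
    rw [← ha]
    field_simp at this
    linear_combination this
  have h2 : toMD h (g * a) = toMD h (partialOS i h * ξ) := toMD_eq_iff.mpr ⟨_, h1⟩
  refine mem_idealToMD_top.mpr ⟨a, ?_⟩
  apply (IsLocalization.map_units (MD h) (⟨toOD h g, hg⟩ : (OD h)⁰)).mul_right_cancel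
  change toMD h a * toMD h g = toMD h (partialOS i h) * f * toMD h g
  rw [mul_assoc, hfg, ← map_mul, ← map_mul, mul_comm a, h2]

theorem mul_mem_of_mem_jacobianIdeal {n : ℕ} {h : OS n} {f : MD h}
    (hf : ∀ i, partialOS i h ∈ multipliers h f) {x : OD h} (hx : x ∈ jacobianIdeal h) :
    algebraMap (OD h) (MD h) x * f ∈ idealToMD h ⊤ := by
  induction hx using Submodule.span_induction with
  | mem x hx =>
    obtain ⟨i, rfl⟩ := hx
    exact hf i
  | zero => simp
  | add x y _ _ hx hy => rw [map_add, add_mul]; exact add_mem hx hy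
  | smul r x _ hx =>
    rw [smul_eq_mul, map_mul, mul_assoc, ← Algebra.smul_def]
    exact Submodule.smul_mem _ r hx

end LogRes

end

/-! ### Assembly of the chain -/

theorem corollary3p5 (n : ℕ) (h : LogRes.OS n) (h_ne_zero : h ≠ 0)
    (h_vanishes : MvPowerSeries.constantCoeff (LogRes.toSeries n h) = 0)
    (h_reduced : IsReduced (LogRes.OD h)) :
    -- all terms of the chain are fractional ideals
    (LogRes.IsFractionalIdeal h (LogRes.idealToMD h (LogRes.jacobianIdeal h)) ∧
      LogRes.IsFractionalIdeal h (LogRes.dual h (LogRes.residues h)) ∧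
      LogRes.IsFractionalIdeal h (LogRes.idealToMD h (LogRes.conductorIdeal h)) ∧
      LogRes.IsFractionalIdeal h (LogRes.idealToMD h ⊤) ∧
      LogRes.IsFractionalIdeal h (LogRes.normalization h).toSubmodule ∧
      LogRes.IsFractionalIdeal h (LogRes.residues h)) ∧
    -- the conductor ideal is the dual of the normalization
    LogRes.idealToMD h (LogRes.conductorIdeal h) =
      LogRes.dual h (LogRes.normalization h).toSubmodule ∧
    -- the chain of inclusions
    LogRes.idealToMD h (LogRes.jacobianIdeal h) ≤ LogRes.dual h (LogRes.residues h) ∧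
    LogRes.dual h (LogRes.residues h) ≤ LogRes.idealToMD h (LogRes.conductorIdeal h) ∧
    LogRes.idealToMD h (LogRes.conductorIdeal h) ≤ LogRes.idealToMD h ⊤ ∧
    LogRes.idealToMD h ⊤ ≤ (LogRes.normalization h).toSubmodule ∧
    (LogRes.normalization h).toSubmodule ≤ LogRes.residues h ∧
    -- in particular
    LogRes.jacobianIdeal h ≤ LogRes.conductorIdeal h := by
  open LogRes nonZeroDivisors in
  obtain _ | n := n
  -- In dimension zero a series without constant term is zero.
  · exact absurd (eq_zero_of_constantCoeff_eq_zero h_vanishes) h_ne_zero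
  have hNR : (normalization h).toSubmodule ≤ residues h := fun f hf =>
    mem_residues_of_forall h_ne_zero (partialOS_mem_multipliers h_ne_zero hf)
  have hJR : ∀ x ∈ jacobianIdeal h, ∀ f ∈ residues h,
      algebraMap (OD h) (MD h) x * f ∈ idealToMD h ⊤ := fun x hx f hf =>
    mul_mem_of_mem_jacobianIdeal (partialOS_mem_multipliers_of_mem_residues h_ne_zero hf) hx
  have hON : idealToMD h ⊤ ≤ (normalization h).toSubmodule := by
    rintro _ ⟨b, -, rfl⟩
    exact (normalization h).algebraMap_mem b
  have hCO : idealToMD h (conductorIdeal h) ≤ idealToMD h ⊤ := Submodule.map_mono le_top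
  have hC : idealToMD h (conductorIdeal h) = dual h (normalization h).toSubmodule := by
    apply le_antisymm
    · rintro _ ⟨a, ha, rfl⟩
      refine mem_dual.mpr fun y hy => ?_
      obtain ⟨b, hb⟩ := ha y hy
      refine ⟨b, trivial, ?_⟩
      rw [Algebra.smul_def] at hb
      exact hb.symm
    · intro x hx
      rw [mem_dual] at hx
      -- The normalization contains `1`, so its dual lies in `𝒪_D`.
      obtain ⟨a, -, rfl⟩ : x ∈ idealToMD h ⊤ := by
        simpa using hx 1 (normalization h).one_mem
      refine ⟨a, fun b hb => ?_, rfl⟩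
      obtain ⟨b', -, hb'⟩ := hx b hb
      exact ⟨b', by rw [Algebra.smul_def]; exact hb'.symm⟩
  have hJ : idealToMD h (jacobianIdeal h) ≤ dual h (residues h) := by
    rintro _ ⟨x, hx, rfl⟩
    exact mem_dual.mpr fun y hy => hJR x hx y hy
  have hRC : dual h (residues h) ≤ idealToMD h (conductorIdeal h) := by
    rw [hC]
    exact fun x hx => mem_dual.mpr fun y hy => mem_dual.mp hx y (hNR hy)
  have : IsNoetherianRing (OD h) := Ideal.Quotient.isNoetherianRing _
  have hfg : ∀ I : Ideal (OD h), (idealToMD h I).FG := fun I =>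
    Submodule.FG.map _ (IsNoetherian.noetherian I)
  obtain ⟨x, hxJ, hx⟩ := exists_mem_jacobianIdeal_nonZeroDivisors h_ne_zero
  have hxu : IsUnit (algebraMap (OD h) (MD h) x) :=
    IsLocalization.map_units (MD h) (⟨x, hx⟩ : (OD h)⁰)
  -- Multiplication by the nonzerodivisor `x` of the Jacobian ideal embeds the residues into the
  -- noetherian `𝒪_D`.
  have hRfg : (residues h).FG := by
    refine Submodule.fg_of_fg_map_injective (LinearMap.mulLeft (OD h) (algebraMap (OD h) (MD h) x))
      (fun a b hab => hxu.mul_left_cancel hab) (Submodule.FG.of_le (hfg ⊤) ?_)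
    rintro _ ⟨f, hf, rfl⟩
    exact hJR x hxJ f hf
  -- Anything between the two ends inherits a nonzerodivisor from below and finiteness from above.
  have key : ∀ I : Submodule (OD h) (MD h), idealToMD h (jacobianIdeal h) ≤ I →
      I ≤ residues h → IsFractionalIdeal h I := fun I h1 h2 =>
    ⟨Submodule.FG.of_le hRfg h2, _, h1 ⟨x, hxJ, rfl⟩, hxu.mem_nonZeroDivisors⟩
  have hOR := hON.trans hNR
  have hJC := hJ.trans hRC
  have hCR := hCO.trans hOR
  refine ⟨⟨key _ le_rfl (hJC.trans hCR), key _ hJ (hRC.trans hCR), key _ hJC hCR,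
    key _ (hJC.trans hCO) hOR, key _ ((hJC.trans hCO).trans hON) hNR,
    key _ (((hJC.trans hCO).trans hON).trans hNR) le_rfl⟩, hC, hJ, hRC, hCO, hON, hNR, ?_⟩
  intro y hy
  obtain ⟨z, hz, hzy⟩ := hJC ⟨y, hy, rfl⟩
  rwa [← algebraMap_MD_injective h hzy]
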